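/- Let $d\ge 4$, let $\hat U$ be a unitary on $\mathbb{C}^d$ (the ideal gate), let $\mathcal{G}$ be a completely positive trace-preserving map on the operators on $\mathbb{C}^d$ (the implemented gate), and let $\mathcal{E}=\mathcal{U}^\dagger\circ\mathcal{G}$, with $\mathcal{U}^\dagger(\hat\rho)=\hat U^\dagger\hat\rho\,\hat U$, be the interaction-picture error channel. Assume that (i) $\mathcal{E}$ is unital, $\mathcal{E}(\mathbb{1})=\mathbb{1}$, and leakage-free (trace-preserving on $\mathbb{C}^d$), and (ii) $\mathcal{E}$ is coherent, i.e. $\mathcal{E}(\hat\rho)=\hat X\hat\rho\hat X^\dagger$ for some unitary $\hat X$ on $\mathbb{C}^d$. Let $d\psi$ be the Haar probability measure on pure states of $\mathbb{C}^d$, let $f(\psi)=\langle\psi|\mathcal{E}(|\psi\rangle\langle\psi|)|\psi\rangle$, and put \[ F=\int d\psi\, f(\psi),\qquad D=\sqrt{\int d\psi\, f(\psi)^2-F^2},\qquad r=1-F,\qquad u=\frac{d}{d-1}\int d\psi\,\operatorname{tr}\Bigl[\mathcal{E}\bigl(|\psi\rangle\langle\psi|-\tfrac{\mathbb{1}}{d}\bigr)\Bigr]^2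 , \] where $\operatorname{tr}[A]^2$ denotes the trace of $A^2$. Let \[ d_\diamond(\mathcal{E},\mathcal{I})=\tfrac12\max_{\hat\rho}\bigl\|(\mathcal{E}\otimes\mathcal{I})(\hat\rho)-\hat\rho\bigr\|_1 , \] the maximum being over density operators $\hat\rho$ on $\mathbb{C}^d\otimes\mathbb{C}^d$. Define $P,Q\ge 0$ by \[ P^2=d(d+1)F-d,\qquad Q^2=d(d+1)(d+2)(d+3)(D^2+F^2)-2d(d+3)-4(d+2)P^2, \] and set \[ c(F,D)=\max\Bigl\{\frac Pd-\frac{\sqrt{(d-2)\,(dQ+d^2-(d+2)P^2)}}{2d},\,0\Bigr\},\qquad c_d=\frac12\sqrt{1-\frac1{d^2}}, \] \[ B_{ru}(r,u)=d^2c_d\sqrt{u+\frac{2dr}{d-1}-1},\qquad B_{FD}(F,D)=\sqrt{1-c(F,D)^2}. \] Then \[ d_\diamond(\mathcal{E},\mathcal{I})\le\min\{B_{ru}(r,u),\,B_{FD}(F,D)\}. \] -/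

import Mathlib

open MeasureTheory
open scoped ComplexOrder Matrix

noncomputable section

namespace HybridCert

/-- Linear maps on the `d × d` complex matrices, i.e. on operators on `ℂ^d`. -/
abbrev Superop (d : ℕ) : Type :=
  Matrix (Fin d) (Fin d) ℂ →ₗ[ℂ] Matrix (Fin d) (Fin d) ℂ

/-- The map `Φ ⊗ id` on operators on `ℂ^d ⊗ ℂ^k` (first index: system, second index: ancilla):
`Φ` is applied to the `(a, b)` ancilla block, for every `a` and `b`. -/
def ampl {d : ℕ} (Φ : Superop d) (k : ℕ) (ρ : Matrix (Fin d × Fin k) (Fin d × Fin k) ℂ) :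
    Matrix (Fin d × Fin k) (Fin d × Fin k) ℂ :=
  Matrix.of fun p q => Φ (Matrix.of fun i j => ρ (i, p.2) (j, q.2)) p.1 q.1

/-- Complete positivity: every amplification preserves positive semidefiniteness. -/
def IsCompletelyPositive {d : ℕ} (Φ : Superop d) : Prop :=
  ∀ (k : ℕ) (ρ : Matrix (Fin d × Fin k) (Fin d × Fin k) ℂ),
    ρ.PosSemidef → (ampl Φ k ρ).PosSemidef

/-- Trace preservation: no population is lost from the space `ℂ^d`, that is, no leakage. -/
def IsTracePreserving {d : ℕ} (Φ : Superop d) : Prop :=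
  ∀ ρ : Matrix (Fin d) (Fin d) ℂ, (Φ ρ).trace = ρ.trace

/-- Quantum channels: completely positive trace-preserving maps. -/
structure IsChannel {d : ℕ} (Φ : Superop d) : Prop where
  completelyPositive : IsCompletelyPositive Φ
  tracePreserving : IsTracePreserving Φ

/-- Unital maps. -/
def IsUnital {d : ℕ} (Φ : Superop d) : Prop := Φ 1 = 1

/-- The map `ρ ↦ X ρ X†`. -/
def conjMap {d : ℕ} (X : Matrix (Fin d) (Fin d) ℂ) : Superop d where
  toFun ρ := X * ρ * Xᴴ
  map_add' ρ σ := by rw [mul_add, add_mul]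
  map_smul' c ρ := by simp

/-- Coherent errors: `Φ(ρ) = X ρ X†` for some unitary `X`. -/
def IsUnitaryChannel {d : ℕ} (Φ : Superop d) : Prop :=
  ∃ X ∈ Matrix.unitaryGroup (Fin d) ℂ, Φ = conjMap X

/-- The interaction-picture error channel `𝒰† ∘ 𝒢` of an implementation `G` of the ideal gate `U`;
here `𝒰†(ρ) = U† ρ U`. -/
def errorChannel {d : ℕ} (U : Matrix (Fin d) (Fin d) ℂ) (G : Superop d) : Superop d :=
  conjMap Uᴴ ∘ₗ G

/-- The trace norm: the sum of the singular values. -/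
def traceNorm {n : Type} [Fintype n] [DecidableEq n] (A : Matrix n n ℂ) : ℝ :=
  ∑ i, √((Matrix.isHermitian_conjTranspose_mul_self A).eigenvalues i)

/-- Density operators. -/
def IsDensity {n : Type} [Fintype n] (ρ : Matrix n n ℂ) : Prop :=
  ρ.PosSemidef ∧ ρ.trace = 1

/-- The normalized diamond distance
`½ max_ρ ‖(Φ ⊗ id)(ρ) - (Ψ ⊗ id)(ρ)‖₁`, over density operators `ρ` on `ℂ^d ⊗ ℂ^d`. -/
def diamondDist {d : ℕ} (Φ Ψ : Superop d) : ℝ :=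
  1 / 2 * sSup {t : ℝ | ∃ ρ : Matrix (Fin d × Fin d) (Fin d × Fin d) ℂ,
    IsDensity ρ ∧ t = traceNorm (ampl Φ d ρ - ampl Ψ d ρ)}

/-- Unit vectors of `ℂ^d`. -/
abbrev UnitVec (d : ℕ) : Type := Metric.sphere (0 : EuclideanSpace ℂ (Fin d)) 1

/-- The (unnormalized) unitarily invariant measure on the unit sphere of `ℂ^d`: the surface measure
derived from Lebesgue measure on `ℂ^d`. -/
def sphereMeasure (d : ℕ) : Measure (UnitVec d) :=
  ((volume : Measure (Fin d → ℂ)).map (WithLp.toLp 2)).toSphere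

/-- The Haar average `∫ dψ g(ψ)` over pure states, normalized so that `∫ dψ 1 = 1`. -/
def haarAvg (d : ℕ) (g : UnitVec d → ℝ) : ℝ := ⨍ ψ, g ψ ∂(sphereMeasure d)

/-- The projection `|ψ⟩⟨ψ|`. -/
def proj {d : ℕ} (ψ : UnitVec d) : Matrix (Fin d) (Fin d) ℂ :=
  Matrix.of fun i j => ψ.1 i * star (ψ.1 j)

/-- The state-dependent fidelity `f(ψ) = ⟨ψ|Φ(|ψ⟩⟨ψ|)|ψ⟩`. -/
def stateFid {d : ℕ} (Φ : Superop d) (ψ : UnitVec d) : ℝ :=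
  (∑ i, ∑ j, star (ψ.1 i) * Φ (proj ψ) i j * ψ.1 j).re

/-- The gate fidelity `F = ∫ dψ f(ψ)`. -/
def gateFid {d : ℕ} (Φ : Superop d) : ℝ := haarAvg d (stateFid Φ)

/-- The fidelity deviation `D = √(∫ dψ f(ψ)² - F²)`. -/
def fidDev {d : ℕ} (Φ : Superop d) : ℝ :=
  √(haarAvg d (fun ψ => stateFid Φ ψ ^ 2) - gateFid Φ ^ 2)

/-- The average infidelity `r = 1 - F`. -/
def infid {d : ℕ} (Φ : Superop d) : ℝ := 1 - gateFid Φ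

/-- The unitarity `u = d/(d-1) ∫ dψ tr[Φ(|ψ⟩⟨ψ| - 𝟙/d)²]`. -/
def unitarity {d : ℕ} (Φ : Superop d) : ℝ :=
  (d : ℝ) / ((d : ℝ) - 1) * haarAvg d (fun ψ =>
    ((Φ (proj ψ - (d : ℂ)⁻¹ • 1)) ^ 2).trace.re)

/-- `P(F)`, where `P² = d(d+1)F - d`. -/
def invP (d : ℕ) (F : ℝ) : ℝ := √((d : ℝ) * (d + 1) * F - d)

/-- `Q(F,D)`, where `Q² = d(d+1)(d+2)(d+3)(D²+F²) - 2d(d+3) - 4(d+2)P²`. -/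
def invQ (d : ℕ) (F D : ℝ) : ℝ :=
  √((d : ℝ) * (d + 1) * (d + 2) * (d + 3) * (D ^ 2 + F ^ 2) - 2 * d * (d + 3)
    - 4 * (d + 2) * invP d F ^ 2)

/-- The certified overlap `c(F,D)`. -/
def certOverlap (d : ℕ) (F D : ℝ) : ℝ :=
  max (invP d F / d
    - √(((d : ℝ) - 2) * (d * invQ d F D + d ^ 2 - (d + 2) * invP d F ^ 2)) / (2 * d)) 0

/-- The constant `c_d = ½ √(1 - 1/d²)`. -/
def cConst (d : ℕ) : ℝ := 1 / 2 * √(1 - 1 / (d : ℝ) ^ 2)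

/-- The bound `B_ru(r,u) = d² c_d √(u + 2dr/(d-1) - 1)`. -/
def boundRU (d : ℕ) (r u : ℝ) : ℝ :=
  (d : ℝ) ^ 2 * cConst d * √(u + 2 * d * r / ((d : ℝ) - 1) - 1)

/-- The bound `B_FD(F,D) = √(1 - c(F,D)²)`. -/
def boundFD (d : ℕ) (F D : ℝ) : ℝ := √(1 - certOverlap d F D ^ 2)

end HybridCert

end

open HybridCert

/-! Diagonalize the coherent error as `X = W diag(l) Wᴴ` with `|l j| = 1`. For a state `ρ` on system
and ancilla and `V = X ⊗ 1`, the trace norm of `V ρ Vᴴ - ρ` is at most `2√(1 - |tr(Vρ)|²)`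
(`traceNorm_unitary_conj_sub_le`), and `tr(Vρ)` is a convex combination `z = ∑ p j * l j`
(`exists_trace_kronecker_one_mul_eq`). Hence it suffices to bound `√(1 - |z|²)` for every choice of
weights.

The data `F`, `D`, `u` determine spectral quantities. Haar averages are ratios of Gaussian
integrals, and unitary invariance reduces these to moments of `∑ l j * |x j|²`. The result is `P =
|tr X|` (`gateFid_conjMap`), `|(tr X)² + tr X²| ≤ Q` (`haarAvg_stateFid_sq_conjMap`, `le_invQ`) and
`u = 1`.

For `B_FD`, rotate the phase so that `tr X ≥ 0`. The eigenvalues lie on an arc, so `|z|` is at least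
the mean of the two smallest real parts (`re_add_re_le_two_mul_norm`). A Samuelson-type inequality
bounds that mean below through the sum and the sum of squares of the real parts, which `P` and `Q`
control (`overlap_le_norm`).

For `B_ru`, `1 - |z|²` is a weighted sum of the `|l i - l j|² / 2` with weights at most one, so it
is at most `d² - P²` (`one_sub_norm_sq_le`), while `B_ru² = (d²/2)(d² - P²)`. -/

noncomputable section

namespace HybridCert

/-! ### Spectral theorem for unitary matrices -/

section Spectral

open Module End

variable {E : Type*} [NormedAddCommGroup E] [InnerProductSpace ℂ E] {T : E →ₗ[ℂ] E}

theorem star_mul_self_eq_one_of_isometry_eigenvector (hT : ∀ x y, inner ℂ (T x) (T y) = inner ℂ x y)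
    {v : E} {a : ℂ} (hv : T v = a • v) (hv0 : v ≠ 0) : star a * a = 1 := by
  have h := hT v v
  rw [hv, inner_smul_left, inner_smul_right, ← mul_assoc] at h
  exact mul_right_cancel₀ (inner_self_ne_zero.mpr hv0) (h.trans (one_mul _).symm)

theorem orthogonalFamily_eigenspaces_of_isometry
    (hT : ∀ x y, inner ℂ (T x) (T y) = inner ℂ x y) :
    OrthogonalFamily ℂ (fun a => eigenspace T a) fun a => (eigenspace T a).subtypeₗᵢ := by
  rintro a b hab ⟨v, hv⟩ ⟨w, hw⟩
  by_cases hv0 : v = 0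
  · simp [hv0]
  rw [mem_eigenspace_iff] at hv hw
  have ha := star_mul_self_eq_one_of_isometry_eigenvector hT hv hv0
  have h := hT v w
  rw [hv, hw, inner_smul_left, inner_smul_right, ← mul_assoc] at h
  by_contra hne
  have hab' : star a * b = 1 := mul_right_cancel₀ hne (h.trans (one_mul _).symm)
  have ha0 : star a ≠ 0 := fun h0 => by simp [h0] at ha
  exact hab (mul_left_cancel₀ ha0 (ha.trans hab'.symm))

/-- The complement is `T`-invariant because eigenvalues are nonzero. If it were nontrivial it would
contain an eigenvector, which would then be orthogonal to itself. -/
theorem iSup_eigenspaces_orthogonal_eq_bot_of_isometry [FiniteDimensional ℂ E]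
    (hT : ∀ x y, inner ℂ (T x) (T y) = inner ℂ x y) : (⨆ a, eigenspace T a)ᗮ = ⊥ := by
  have hinv : ∀ v ∈ (⨆ a, eigenspace T a)ᗮ, T v ∈ (⨆ a, eigenspace T a)ᗮ := by
    intro v hv
    rw [← Submodule.iInf_orthogonal, Submodule.mem_iInf] at hv ⊢
    intro a w hw
    by_cases hw0 : w = 0
    · simp [hw0]
    have hw' := mem_eigenspace_iff.mp hw
    have ha := star_mul_self_eq_one_of_isometry_eigenvector hT hw' hw0
    have h := hT w v
    rw [hv a w hw, hw', inner_smul_left] at h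
    refine (mul_eq_zero.mp h).resolve_left fun h0 => ?_
    rw [show star a = 0 from h0] at ha
    simp at ha
  by_contra hne
  have : Nontrivial ↥(⨆ a, eigenspace T a)ᗮ := Submodule.nontrivial_iff_ne_bot.mpr hne
  obtain ⟨a, ha⟩ := exists_eigenvalue (T.restrict hinv)
  obtain ⟨v, hv, hv0⟩ := ha.exists_hasEigenvector
  rw [mem_eigenspace_iff] at hv
  have hv' : T v = a • (v : E) := congrArg Subtype.val hv
  have hmem : (v : E) ∈ ⨆ a, eigenspace T a :=
    (le_iSup (fun a => eigenspace T a) a) (mem_eigenspace_iff.mpr hv')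
  have := v.2 v hmem
  exact hv0 (Subtype.ext (inner_self_eq_zero.mp this))

theorem exists_orthonormalBasis_eigenvectors_of_isometry [FiniteDimensional ℂ E] {n : ℕ}
    (hn : Module.finrank ℂ E = n) (hT : ∀ x y, inner ℂ (T x) (T y) = inner ℂ x y) :
    ∃ (b : OrthonormalBasis (Fin n) ℂ E) (a : Fin n → ℂ), ∀ j, T (b j) = a j • b j := by
  classical
  have hint : DirectSum.IsInternal fun a : Eigenvalues T => eigenspace T a :=
    ((orthogonalFamily_eigenspaces_of_isometry hT).comp Subtype.coe_injective).isInternal_iff.mpr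
      (show (⨆ a : { a // eigenspace T a ≠ ⊥ }, eigenspace T a)ᗮ = ⊥ by
        rw [iSup_ne_bot_subtype, iSup_eigenspaces_orthogonal_eq_bot_of_isometry hT])
  have hV := (orthogonalFamily_eigenspaces_of_isometry hT).comp
    (Subtype.coe_injective : Function.Injective (Subtype.val : Eigenvalues T → ℂ))
  refine ⟨hint.subordinateOrthonormalBasis hn hV,
    fun j => (hint.subordinateOrthonormalBasisIndex hn j hV).1, fun j => ?_⟩
  exact mem_eigenspace_iff.mp (hint.subordinateOrthonormalBasis_subordinate hn j hV)

end Spectral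

/-- Unitary matrices are unitarily diagonalizable. -/
theorem exists_unitary_diagonalization {d : ℕ} {X : Matrix (Fin d) (Fin d) ℂ}
    (hX : X ∈ Matrix.unitaryGroup (Fin d) ℂ) :
    ∃ W ∈ Matrix.unitaryGroup (Fin d) ℂ, ∃ l : Fin d → ℂ,
      (∀ j, star (l j) * l j = 1) ∧ X = W * Matrix.diagonal l * Wᴴ := by
  have hT : ∀ x y : EuclideanSpace ℂ (Fin d), inner ℂ (Matrix.toEuclideanLin X x)
      (Matrix.toEuclideanLin X y) = inner ℂ x y := by
    intro x y
    rw [← LinearMap.adjoint_inner_right, ← Matrix.toEuclideanLin_conjTranspose_eq_adjoint]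
    congr 1
    rw [Matrix.toLpLin_apply, Matrix.toLpLin_apply]
    simp only [Matrix.mulVec_mulVec]
    rw [← Matrix.star_eq_conjTranspose, Matrix.mem_unitaryGroup_iff'.mp hX, Matrix.one_mulVec]
  obtain ⟨b, l, hb⟩ := exists_orthonormalBasis_eigenvectors_of_isometry
    (finrank_euclideanSpace_fin) hT
  set W : Matrix (Fin d) (Fin d) ℂ :=
    (EuclideanSpace.basisFun (Fin d) ℂ).toBasis.toMatrix b.toBasis with hW
  have hWu : W ∈ Matrix.unitaryGroup (Fin d) ℂ :=
    (EuclideanSpace.basisFun (Fin d) ℂ).toMatrix_orthonormalBasis_mem_unitary b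
  have hWa : ∀ i j, W i j = b j i := fun i j => rfl
  refine ⟨W, hWu, l, fun j => ?_, ?_⟩
  · exact star_mul_self_eq_one_of_isometry_eigenvector hT (hb j) (b.orthonormal.ne_zero j)
  · have hXW : X * W = W * Matrix.diagonal l := by
      ext i j
      have h := congrArg (fun v : EuclideanSpace ℂ (Fin d) => v i) (hb j)
      simp only [Matrix.toLpLin_apply, PiLp.smul_apply, smul_eq_mul] at h
      rw [Matrix.mul_diagonal, hWa, mul_comm, ← h]
      rfl
    rw [← hXW, Matrix.mul_assoc, ← Matrix.star_eq_conjTranspose,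
      Matrix.mem_unitaryGroup_iff.mp hWu, Matrix.mul_one]

/-! ### Trace distance between a state and its unitary image -/

section TraceNorm

variable {n : Type} [Fintype n] [DecidableEq n]

/-- The two indexings need not match, so the comparison is between multisets: both are the roots of
the characteristic polynomial of `Aᴴ * A`. -/
theorem eigenvalues_conjTranspose_mul_self_of_isHermitian {A : Matrix n n ℂ}
    (hA : A.IsHermitian) :
    Multiset.map (Matrix.isHermitian_conjTranspose_mul_self A).eigenvalues Finset.univ.val =
      Multiset.map (fun i => hA.eigenvalues i ^ 2) Finset.univ.val := by
  have h1 := (Matrix.isHermitian_conjTranspose_mul_self A).roots_charpoly_eq_eigenvalues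
  have h2 : (Aᴴ * A).charpoly = ∏ i, (Polynomial.X - Polynomial.C ((hA.eigenvalues i : ℂ) ^ 2)) := by
    rw [hA.eq]
    conv_lhs => rw [hA.spectral_theorem, ← map_mul, Unitary.conjStarAlgAut_apply,
      Matrix.charpoly_mul_comm, ← mul_assoc]
    simp [Matrix.charpoly_diagonal, pow_two]
  rw [h2, Polynomial.roots_prod _ _
    (Finset.prod_ne_zero_iff.mpr fun i _ => Polynomial.X_sub_C_ne_zero _)] at h1
  have h3 := congrArg (Multiset.map Complex.re) h1
  simp only [Polynomial.roots_X_sub_C, Multiset.bind_singleton, Multiset.map_map] at h3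
  refine (Eq.trans ?_ h3.symm).trans ?_
  · exact Multiset.map_congr rfl fun i _ => by simp
  · exact Multiset.map_congr rfl fun i _ => by simp [← Complex.ofReal_pow]

theorem traceNorm_eq_sum_abs_eigenvalues {A : Matrix n n ℂ} (hA : A.IsHermitian) :
    traceNorm A = ∑ i, |hA.eigenvalues i| := by
  have h := congrArg (fun s => (Multiset.map Real.sqrt s).sum)
    (eigenvalues_conjTranspose_mul_self_of_isHermitian hA)
  simp only [Multiset.map_map] at h
  calc traceNorm A = _ := h
    _ = _ := Finset.sum_congr rfl fun i _ => Real.sqrt_sq_eq_abs _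

/-- The trace norm of a traceless Hermitian matrix is twice the sum of its positive eigenvalues. -/
theorem exists_traceNorm_eq_two_mul_sum_diag {A : Matrix n n ℂ} (hA : A.IsHermitian)
    (htr : A.trace = 0) :
    ∃ W ∈ Matrix.unitaryGroup n ℂ, ∃ S : Finset n,
      traceNorm A = 2 * ∑ i ∈ S, ((Wᴴ * A * W) i i).re := by
  refine ⟨hA.eigenvectorUnitary, hA.eigenvectorUnitary.2,
    Finset.univ.filter fun i => 0 < hA.eigenvalues i, ?_⟩
  have hdiag : (hA.eigenvectorUnitary : Matrix n n ℂ)ᴴ * A * (hA.eigenvectorUnitary : Matrix n n ℂ) =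
      Matrix.diagonal (RCLike.ofReal ∘ hA.eigenvalues) := by
    have := hA.conjStarAlgAut_star_eigenvectorUnitary
    rwa [Unitary.conjStarAlgAut_star_apply] at this
  have h0 : ∑ i, hA.eigenvalues i = 0 := by
    have h := hA.trace_eq_sum_eigenvalues
    rw [htr] at h
    have h' := congrArg Complex.re h
    simpa using h'.symm
  -- Adding the vanishing trace replaces `|λ|` by `|λ| + λ`, twice the positive part.
  have h1 : traceNorm A = ∑ i, (|hA.eigenvalues i| + hA.eigenvalues i) := by
    rw [Finset.sum_add_distrib, h0, add_zero, traceNorm_eq_sum_abs_eigenvalues hA]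
  rw [hdiag, h1, Finset.sum_filter, Finset.mul_sum]
  refine Finset.sum_congr rfl fun i _ => ?_
  split_ifs with h
  · simp [abs_of_pos h, two_mul]
  · simp [abs_of_nonpos (not_lt.mp h)]

end TraceNorm

/-- With `x`, `y` the two masses on `S`, Cauchy–Schwarz on `S` and on its complement bounds the
overlap by `√(xy) + √((1-x)(1-y))`. By AM–GM, the square of this plus `(x - y)²` is at most one. -/
theorem sum_sub_sum_le_sqrt {ι : Type*} [Fintype ι] [DecidableEq ι] (a b : ι → ℂ)
    (ha : ∑ i, ‖a i‖ ^ 2 = 1) (hb : ∑ i, ‖b i‖ ^ 2 = 1) (S : Finset ι) :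
    ∑ i ∈ S, ‖a i‖ ^ 2 - ∑ i ∈ S, ‖b i‖ ^ 2 ≤ √(1 - ‖∑ i, star (b i) * a i‖ ^ 2) := by
  apply Real.le_sqrt_of_sq_le
  have ha' := Finset.sum_add_sum_compl S fun i => ‖a i‖ ^ 2
  have hb' := Finset.sum_add_sum_compl S fun i => ‖b i‖ ^ 2
  rw [ha] at ha'
  rw [hb] at hb'
  have hS := Finset.sum_mul_sq_le_sq_mul_sq S (fun i => ‖b i‖) (fun i => ‖a i‖)
  have hC := Finset.sum_mul_sq_le_sq_mul_sq Sᶜ (fun i => ‖b i‖) (fun i => ‖a i‖)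
  have hle : ‖∑ i, star (b i) * a i‖ ≤ ∑ i ∈ S, ‖b i‖ * ‖a i‖ + ∑ i ∈ Sᶜ, ‖b i‖ * ‖a i‖ := by
    rw [Finset.sum_add_sum_compl]
    refine (norm_sum_le _ _).trans (le_of_eq (Finset.sum_congr rfl fun i _ => ?_))
    rw [norm_mul, norm_star]
  have hp : 0 ≤ ∑ i ∈ S, ‖b i‖ * ‖a i‖ := Finset.sum_nonneg fun i _ => by positivity
  have hq : 0 ≤ ∑ i ∈ Sᶜ, ‖b i‖ * ‖a i‖ := Finset.sum_nonneg fun i _ => by positivity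
  have hx0 : 0 ≤ ∑ i ∈ S, ‖a i‖ ^ 2 := Finset.sum_nonneg fun i _ => by positivity
  have hy0 : 0 ≤ ∑ i ∈ S, ‖b i‖ ^ 2 := Finset.sum_nonneg fun i _ => by positivity
  have hx1 : 0 ≤ ∑ i ∈ Sᶜ, ‖a i‖ ^ 2 := Finset.sum_nonneg fun i _ => by positivity
  have hy1 : 0 ≤ ∑ i ∈ Sᶜ, ‖b i‖ ^ 2 := Finset.sum_nonneg fun i _ => by positivity
  generalize ∑ i ∈ S, ‖b i‖ * ‖a i‖ = p at *
  generalize ∑ i ∈ Sᶜ, ‖b i‖ * ‖a i‖ = q at *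
  generalize ∑ i ∈ S, ‖a i‖ ^ 2 = x at *
  generalize ∑ i ∈ S, ‖b i‖ ^ 2 = y at *
  have hx' : ∑ i ∈ Sᶜ, ‖a i‖ ^ 2 = 1 - x := by linarith
  have hy' : ∑ i ∈ Sᶜ, ‖b i‖ ^ 2 = 1 - y := by linarith
  rw [hx'] at hx1 hC
  rw [hy'] at hy1 hC
  have hn := norm_nonneg (∑ i, star (b i) * a i)
  generalize ‖∑ i, star (b i) * a i‖ = m at *
  have hm : m ^ 2 ≤ (p + q) ^ 2 := pow_le_pow_left₀ hn hle 2
  have hpq : p * q ≤ (x * (1 - x) + y * (1 - y)) / 2 := by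
    have h1 : (p * q) ^ 2 ≤ ((x * (1 - x) + y * (1 - y)) / 2) ^ 2 := by
      have h2 : (p * q) ^ 2 ≤ (y * x) * ((1 - y) * (1 - x)) := by
        rw [mul_pow]
        exact mul_le_mul hS hC (sq_nonneg _) (by positivity)
      nlinarith [sq_nonneg (x * (1 - x) - y * (1 - y))]
    exact le_of_sq_le_sq h1 (by positivity)
  nlinarith

theorem sum_norm_sq_eq_trace {m k : Type*} [Fintype m] [Fintype k] (A : Matrix m k ℂ) :
    ((∑ i : m × k, ‖A i.1 i.2‖ ^ 2 : ℝ) : ℂ) = (A * Aᴴ).trace := by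
  simp [Fintype.sum_prod_type, Matrix.trace, Matrix.mul_apply, Complex.mul_conj,
    Complex.normSq_eq_norm_sq]

open scoped MatrixOrder in
/-- Trace distance between a state and its image under a unitary conjugation. -/
theorem traceNorm_unitary_conj_sub_le {n : Type} [Fintype n] [DecidableEq n] {V ρ : Matrix n n ℂ}
    (hV : V ∈ Matrix.unitaryGroup n ℂ) (hρ : IsDensity ρ) :
    traceNorm (V * ρ * Vᴴ - ρ) ≤ 2 * √(1 - ‖(V * ρ).trace‖ ^ 2) := by
  obtain ⟨hpos, htr⟩ := hρ
  have hV1 : Vᴴ * V = 1 := Matrix.mem_unitaryGroup_iff'.mp hV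
  have hA : (V * ρ * Vᴴ - ρ).IsHermitian :=
    (Matrix.isHermitian_mul_mul_conjTranspose V hpos.1).sub hpos.1
  have htr0 : (V * ρ * Vᴴ - ρ).trace = 0 := by
    rw [Matrix.trace_sub, Matrix.trace_mul_comm, ← Matrix.mul_assoc, hV1, Matrix.one_mul, sub_self]
  obtain ⟨W, hW, S, hS⟩ := exists_traceNorm_eq_two_mul_sum_diag hA htr0
  have hW1 : W * Wᴴ = 1 := Matrix.mem_unitaryGroup_iff.mp hW
  obtain ⟨B, hB⟩ : ∃ B : Matrix n n ℂ, ρ = B * Bᴴ := by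
    obtain ⟨B, hB⟩ := (CStarAlgebra.nonneg_iff_eq_star_mul_self (a := ρ)).mp hpos.nonneg
    exact ⟨Bᴴ, by rw [hB, Matrix.conjTranspose_conjTranspose, Matrix.star_eq_conjTranspose]⟩
  -- `V * B` and `B`, read as vectors indexed by `n × n`, purify the two states. They are written in
  -- the eigenbasis `W` of the difference, and their overlap is `tr(Vρ)`.
  set a : Matrix n n ℂ := Wᴴ * V * B with ha
  set b : Matrix n n ℂ := Wᴴ * B with hb
  have haa : a * aᴴ = Wᴴ * (V * ρ * Vᴴ) * W := by
    simp only [ha, hB, Matrix.conjTranspose_mul, Matrix.conjTranspose_conjTranspose,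
      Matrix.mul_assoc]
  have hbb : b * bᴴ = Wᴴ * ρ * W := by
    simp only [hb, hB, Matrix.conjTranspose_mul, Matrix.conjTranspose_conjTranspose,
      Matrix.mul_assoc]
  have htrW : ∀ M : Matrix n n ℂ, (Wᴴ * M * W).trace = M.trace := fun M => by
    rw [Matrix.trace_mul_comm, ← Matrix.mul_assoc, hW1, Matrix.one_mul]
  have ha1 : ∑ i : n × n, ‖a i.1 i.2‖ ^ 2 = 1 := by
    have h := sum_norm_sq_eq_trace a
    rw [haa, htrW, Matrix.trace_mul_comm, ← Matrix.mul_assoc, hV1, Matrix.one_mul, htr] at h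
    exact_mod_cast h
  have hb1 : ∑ i : n × n, ‖b i.1 i.2‖ ^ 2 = 1 := by
    have h := sum_norm_sq_eq_trace b
    rw [hbb, htrW, htr] at h
    exact_mod_cast h
  have key := sum_sub_sum_le_sqrt (fun i : n × n => a i.1 i.2) (fun i => b i.1 i.2) ha1 hb1
    (S ×ˢ Finset.univ)
  have hab : ∑ i : n × n, star (b i.1 i.2) * a i.1 i.2 = (V * ρ).trace := by
    have h1 : (V * ρ).trace = (a * bᴴ).trace := by
      have : a * bᴴ = Wᴴ * (V * ρ) * W := by
        simp only [ha, hb, hB, Matrix.conjTranspose_mul, Matrix.conjTranspose_conjTranspose,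
          Matrix.mul_assoc]
      rw [this, htrW]
    rw [h1]
    simp [Fintype.sum_prod_type, Matrix.trace, Matrix.mul_apply, mul_comm]
  rw [hab, Finset.sum_product, Finset.sum_product, ← Finset.sum_sub_distrib] at key
  rw [hS]
  refine mul_le_mul_of_nonneg_left (le_trans (le_of_eq ?_) key) zero_le_two
  refine Finset.sum_congr rfl fun i _ => ?_
  rw [Matrix.mul_sub, Matrix.sub_mul, ← haa, ← hbb]
  simp only [Matrix.sub_apply, Complex.sub_re, Matrix.mul_apply, Matrix.conjTranspose_apply,
    Complex.re_sum, Complex.star_def, Complex.mul_conj, Complex.normSq_eq_norm_sq,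
    Complex.ofReal_re]

/-! ### Convex combinations of points on the unit circle -/

section Geometry

theorem abs_arg_le_of_cos_le {z : ℂ} (hz : ‖z‖ = 1) {b : ℝ} (hb0 : 0 ≤ b)
    (h : Real.cos b ≤ z.re) : |z.arg| ≤ b := by
  by_contra! hlt
  have h1 := Real.cos_lt_cos_of_nonneg_of_le_pi hb0 (Complex.abs_arg_le_pi z) hlt
  rw [Real.cos_abs, Complex.cos_arg (by rintro rfl; simp at hz), hz, div_one] at h1
  linarith

theorem cos_mul_re_add_sin_mul_im_eq {z : ℂ} (hz : ‖z‖ = 1) (δ : ℝ) :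
    Real.cos δ * z.re + Real.sin δ * z.im = Real.cos (z.arg - δ) := by
  rw [Real.cos_sub, Complex.cos_arg (by rintro rfl; simp at hz), Complex.sin_arg, hz]
  ring

theorem cos_mul_re_add_sin_mul_im_le (z : ℂ) (δ : ℝ) :
    Real.cos δ * z.re + Real.sin δ * z.im ≤ ‖z‖ := by
  rw [Complex.norm_def, Complex.normSq_apply]
  apply Real.le_sqrt_of_sq_le
  nlinarith [Real.sin_sq_add_cos_sq δ, sq_nonneg (Real.cos δ * z.im - Real.sin δ * z.re)]

variable {ι : Type*} [Fintype ι]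

/-- All the points lie on the arc of arguments from `-β` to `α`, with midpoint `δ` and half-width
`(α + β) / 2`. Each has component at least `cos ((α + β) / 2)` along the direction `δ`, hence so
does every convex combination; then `cos α + cos β = 2 cos ((α + β) / 2) cos δ` with `0 ≤ cos δ ≤
1`. -/
theorem re_add_re_le_two_mul_norm_aux {l : ι → ℂ} (hl : ∀ j, ‖l j‖ = 1) {p : ι → ℝ}
    (hp : ∀ j, 0 ≤ p j) (hp1 : ∑ j, p j = 1) {i₀ i₁ : ι}
    (h01 : (l i₀).re ≤ (l i₁).re) (h1 : ∀ j, j ≠ i₀ → (l i₁).re ≤ (l j).re)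
    (him : 0 ≤ (l i₀).im) :
    (l i₀).re + (l i₁).re ≤ 2 * ‖∑ j, (p j : ℂ) * l j‖ := by
  have hbd : ∀ j, -1 ≤ (l j).re ∧ (l j).re ≤ 1 := fun j =>
    abs_le.mp ((Complex.abs_re_le_norm _).trans (hl j).le)
  set α := (l i₀).arg with hα
  set β := Real.arccos (l i₁).re with hβ
  have hcα : Real.cos α = (l i₀).re := by
    have := cos_mul_re_add_sin_mul_im_eq (hl i₀) 0
    simpa using this.symm
  have hcβ : Real.cos β = (l i₁).re := Real.cos_arccos (hbd i₁).1 (hbd i₁).2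
  have hα0 : 0 ≤ α := Complex.arg_nonneg_iff.mpr him
  have hαπ : α ≤ Real.pi := Complex.arg_le_pi _
  have hβ0 : 0 ≤ β := Real.arccos_nonneg _
  have hβπ : β ≤ Real.pi := Real.arccos_le_pi _
  have hβα : β ≤ α := by
    by_contra! hlt
    have := Real.cos_lt_cos_of_nonneg_of_le_pi hα0 hβπ hlt
    linarith
  set δ := (α - β) / 2 with hδ
  have hall : ∀ j, Real.cos ((α + β) / 2) ≤ Real.cos δ * (l j).re + Real.sin δ * (l j).im := by
    intro j
    rw [cos_mul_re_add_sin_mul_im_eq (hl j), ← Real.cos_abs ((l j).arg - δ)]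
    apply Real.cos_le_cos_of_nonneg_of_le_pi (abs_nonneg _) (by linarith)
    by_cases hj : j = i₀
    · subst hj
      rw [abs_le]
      constructor <;> linarith
    · have := abs_le.mp (abs_arg_le_of_cos_le (hl j) hβ0 (hcβ.trans_le (h1 j hj)))
      rw [abs_le]
      constructor <;> linarith
  have hz : Real.cos ((α + β) / 2) ≤ ‖∑ j, (p j : ℂ) * l j‖ := by
    refine le_trans ?_ (cos_mul_re_add_sin_mul_im_le _ δ)
    have : Real.cos δ * (∑ j, (p j : ℂ) * l j).re + Real.sin δ * (∑ j, (p j : ℂ) * l j).im =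
        ∑ j, p j * (Real.cos δ * (l j).re + Real.sin δ * (l j).im) := by
      simp only [Complex.re_sum, Complex.im_sum, Complex.re_ofReal_mul, Complex.im_ofReal_mul,
        Finset.mul_sum, ← Finset.sum_add_distrib]
      exact Finset.sum_congr rfl fun j _ => by ring
    rw [this]
    calc Real.cos ((α + β) / 2) = ∑ j, p j * Real.cos ((α + β) / 2) := by
          rw [← Finset.sum_mul, hp1, one_mul]
      _ ≤ _ := Finset.sum_le_sum fun j _ => mul_le_mul_of_nonneg_left (hall j) (hp j)
  have hδ0 : 0 ≤ Real.cos δ := Real.cos_nonneg_of_neg_pi_div_two_le_of_le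
    (by linarith) (by linarith)
  have hδ1 : Real.cos δ ≤ 1 := Real.cos_le_one δ
  have hsum : (l i₀).re + (l i₁).re = 2 * Real.cos ((α + β) / 2) * Real.cos δ := by
    rw [← hcα, ← hcβ, Real.cos_add_cos]
  rw [hsum]
  nlinarith [norm_nonneg (∑ j, (p j : ℂ) * l j)]

/-- The two smallest real parts among unit complex numbers have mean at most the norm of any of
their convex combinations. -/
theorem re_add_re_le_two_mul_norm {l : ι → ℂ} (hl : ∀ j, ‖l j‖ = 1) {p : ι → ℝ}
    (hp : ∀ j, 0 ≤ p j) (hp1 : ∑ j, p j = 1) {i₀ i₁ : ι}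
    (h01 : (l i₀).re ≤ (l i₁).re) (h1 : ∀ j, j ≠ i₀ → (l i₁).re ≤ (l j).re) :
    (l i₀).re + (l i₁).re ≤ 2 * ‖∑ j, (p j : ℂ) * l j‖ := by
  rcases le_total 0 (l i₀).im with him | him
  · exact re_add_re_le_two_mul_norm_aux hl hp hp1 h01 h1 him
  -- Complex conjugation reflects this case to the previous one.
  · have h := re_add_re_le_two_mul_norm_aux (l := fun j => star (l j)) (p := p)
      (fun j => by rw [norm_star, hl]) hp hp1 (i₀ := i₀) (i₁ := i₁) (by simpa using h01)
      (by simpa using h1) (by simpa using him)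
    have hs : ∑ j, (p j : ℂ) * star (l j) = star (∑ j, (p j : ℂ) * l j) := by simp
    rw [hs, norm_star] at h
    simpa using h

/-- A sharpening of Samuelson's inequality for the mean of two entries. -/
theorem mean_sub_two_mean_le [DecidableEq ι] (y : ι → ℝ) {i₀ i₁ : ι} (hne : i₁ ≠ i₀)
    (d : ℝ) (hd : d = Fintype.card ι) :
    (∑ j, y j) / d - (y i₀ + y i₁) / 2 ≤
      √((d - 2) * (2 * d * ∑ j, y j ^ 2 - 2 * (∑ j, y j) ^ 2)) / (2 * d) := by
  have hmem : i₁ ∈ Finset.univ.erase i₀ := Finset.mem_erase.mpr ⟨hne, Finset.mem_univ _⟩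
  have hcard : (((Finset.univ.erase i₀).erase i₁).card : ℝ) = d - 2 := by
    have h1 := Finset.card_erase_add_one hmem
    have h2 := Finset.card_erase_add_one (Finset.mem_univ i₀)
    rw [Finset.card_univ] at h2
    rw [hd, ← h2, ← h1]
    push_cast
    ring
  have hd0 : 0 < d := by
    rw [hd]
    exact_mod_cast Fintype.card_pos_iff.mpr ⟨i₀⟩
  -- Cauchy–Schwarz on the `d - 2` remaining entries; the other slack is a multiple of `(y i₀ - y
  -- i₁)²`.
  have hcs := sq_sum_le_card_mul_sum_sq (s := (Finset.univ.erase i₀).erase i₁) (f := y)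
  rw [hcard] at hcs
  have e1 : ∀ f : ι → ℝ, ∑ j, f j = f i₀ + (f i₁ + ∑ j ∈ (Finset.univ.erase i₀).erase i₁, f j) :=
    fun f => by
      rw [Finset.add_sum_erase _ _ hmem, Finset.add_sum_erase _ _ (Finset.mem_univ i₀)]
  have hd2 : 0 ≤ d - 2 := hcard ▸ Nat.cast_nonneg _
  rw [div_sub_div _ _ hd0.ne' two_ne_zero, mul_comm d 2]
  refine div_le_div_of_nonneg_right (Real.le_sqrt_of_sq_le ?_) (by positivity)
  rw [e1 y, e1 fun j => y j ^ 2]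
  generalize ∑ j ∈ (Finset.univ.erase i₀).erase i₁, y j = R at *
  generalize ∑ j ∈ (Finset.univ.erase i₀).erase i₁, y j ^ 2 = S at *
  nlinarith [mul_le_mul_of_nonneg_left hcs hd0.le,
    mul_nonneg (mul_nonneg hd2 hd0.le) (sq_nonneg (y i₀ - y i₁))]

/-- Lower bound on the norm of a convex combination of the eigenvalues `l` of a unitary in terms
of the power sums `∑ l` and `∑ l ^ 2`. -/
theorem overlap_le_norm {d : ℕ} (hd : 2 ≤ d) {l : Fin d → ℂ} (hl : ∀ j, ‖l j‖ = 1)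
    {p : Fin d → ℝ} (hp : ∀ j, 0 ≤ p j) (hp1 : ∑ j, p j = 1) {q : ℝ}
    (hq : ‖(∑ j, l j) ^ 2 + ∑ j, l j ^ 2‖ ≤ q) :
    ‖∑ j, l j‖ / d -
      √(((d : ℝ) - 2) * (d * q + d ^ 2 - (d + 2) * ‖∑ j, l j‖ ^ 2)) / (2 * d) ≤
      ‖∑ j, (p j : ℂ) * l j‖ := by
  -- The phase `e` makes the trace real and nonnegative without changing any norm.
  obtain ⟨e, he, heT⟩ : ∃ e : ℂ, ‖e‖ = 1 ∧ e * ∑ j, l j = ‖∑ j, l j‖ := by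
    by_cases h0 : ∑ j, l j = 0
    · exact ⟨1, by simp, by simp [h0]⟩
    · have hn : ‖∑ j, l j‖ ≠ 0 := norm_ne_zero_iff.mpr h0
      refine ⟨star (∑ j, l j) / ‖∑ j, l j‖, ?_, ?_⟩
      · rw [norm_div, norm_star, Complex.norm_real, norm_norm, div_self hn]
      · rw [div_mul_eq_mul_div, Complex.star_def, Complex.conj_mul', pow_two,
          mul_div_assoc, div_self (by exact_mod_cast hn), mul_one]
  have hl' : ∀ j, ‖e * l j‖ = 1 := fun j => by rw [norm_mul, he, hl, one_mul]
  have : Nonempty (Fin d) := ⟨⟨0, by omega⟩⟩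
  obtain ⟨i₀, -, h0⟩ := Finset.exists_min_image Finset.univ (fun j => (e * l j).re)
    Finset.univ_nonempty
  obtain ⟨i₁, hi₁, h1⟩ := Finset.exists_min_image (Finset.univ.erase i₀) (fun j => (e * l j).re)
    (Finset.card_pos.mp (by rw [Finset.card_erase_of_mem (Finset.mem_univ _)]; simp; omega))
  have hne : i₁ ≠ i₀ := Finset.ne_of_mem_erase hi₁
  have hhull := re_add_re_le_two_mul_norm hl' hp hp1 (h0 i₁ (Finset.mem_univ _))
    fun j hj => h1 j (Finset.mem_erase.mpr ⟨hj, Finset.mem_univ _⟩)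
  have hz : ∑ j, (p j : ℂ) * (e * l j) = e * ∑ j, (p j : ℂ) * l j := by
    rw [Finset.mul_sum]
    exact Finset.sum_congr rfl fun j _ => by ring
  rw [hz, norm_mul, he, one_mul] at hhull
  have hsam := mean_sub_two_mean_le (fun j => (e * l j).re) hne (d : ℝ) (by simp)
  have hT : ∑ j, (e * l j).re = ‖∑ j, l j‖ := by
    rw [← Complex.re_sum, ← Finset.mul_sum, heT, Complex.ofReal_re]
  rw [hT] at hsam
  -- On the unit circle `Re z² = 2 (Re z)² - 1`, so the bound `q` controls the sum of squared real
  -- parts.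
  have hsq : ∀ j, ((e * l j) ^ 2).re = 2 * (e * l j).re ^ 2 - 1 := fun j => by
    have h := Complex.sq_norm (e * l j)
    rw [hl', Complex.normSq_apply] at h
    rw [pow_two, Complex.mul_re]
    linarith
  have hq' : ‖∑ j, l j‖ ^ 2 + 2 * ∑ j, (e * l j).re ^ 2 - d ≤ q := by
    refine le_trans ?_ hq
    have h := Complex.re_le_norm (e ^ 2 * ((∑ j, l j) ^ 2 + ∑ j, l j ^ 2))
    rw [norm_mul, norm_pow, he, one_pow, one_mul] at h
    refine le_trans (le_of_eq ?_) h
    have : e ^ 2 * ((∑ j, l j) ^ 2 + ∑ j, l j ^ 2) =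
        (e * ∑ j, l j) ^ 2 + ∑ j, (e * l j) ^ 2 := by
      simp only [mul_pow, ← Finset.mul_sum]
      ring
    rw [this, heT, Complex.add_re, Complex.re_sum, Finset.sum_congr rfl fun j _ => hsq j,
      ← Complex.ofReal_pow, Complex.ofReal_re, Finset.sum_sub_distrib, ← Finset.mul_sum]
    simp
    ring
  have hd2 : (0 : ℝ) ≤ (d : ℝ) - 2 := by
    have : (2 : ℝ) ≤ d := by exact_mod_cast hd
    linarith
  have hmono : √(((d : ℝ) - 2) * (2 * d * ∑ j, (e * l j).re ^ 2 - 2 * ‖∑ j, l j‖ ^ 2)) / (2 * d) ≤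
      √(((d : ℝ) - 2) * (d * q + d ^ 2 - (d + 2) * ‖∑ j, l j‖ ^ 2)) / (2 * d) := by
    refine div_le_div_of_nonneg_right (Real.sqrt_le_sqrt ?_) (by positivity)
    refine mul_le_mul_of_nonneg_left ?_ hd2
    nlinarith [mul_le_mul_of_nonneg_left hq' (Nat.cast_nonneg (α := ℝ) d)]
  linarith

theorem norm_sub_sq_of_norm_eq_one {a b : ℂ} (ha : ‖a‖ = 1) (hb : ‖b‖ = 1) :
    (a * star b).re = 1 - ‖a - b‖ ^ 2 / 2 := by
  rw [Complex.sq_norm, Complex.normSq_sub, ← Complex.sq_norm, ← Complex.sq_norm, ha, hb]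
  simp
  ring

theorem norm_sum_mul_sq_eq {l : ι → ℂ} (hl : ∀ j, ‖l j‖ = 1) (p : ι → ℝ) :
    ‖∑ j, (p j : ℂ) * l j‖ ^ 2 =
      (∑ j, p j) ^ 2 - ∑ i, ∑ j, p i * p j * (‖l i - l j‖ ^ 2 / 2) := by
  have h : (((‖∑ j, (p j : ℂ) * l j‖ ^ 2 : ℝ)) : ℂ) =
      (∑ j, (p j : ℂ) * l j) * star (∑ j, (p j : ℂ) * l j) := by
    rw [Complex.star_def, Complex.mul_conj, Complex.normSq_eq_norm_sq]
  have h' := congrArg Complex.re h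
  rw [Complex.ofReal_re, star_sum, Finset.sum_mul_sum, Complex.re_sum] at h'
  rw [h', pow_two, Finset.sum_mul_sum, ← Finset.sum_sub_distrib]
  refine Finset.sum_congr rfl fun i _ => ?_
  rw [Complex.re_sum, ← Finset.sum_sub_distrib]
  refine Finset.sum_congr rfl fun j _ => ?_
  have : (p i : ℂ) * l i * star ((p j : ℂ) * l j) = ((p i * p j : ℝ) : ℂ) * (l i * star (l j)) := by
    simp
    ring
  rw [this, Complex.re_ofReal_mul, norm_sub_sq_of_norm_eq_one (hl i) (hl j)]
  ring

/-- Both sides are sums of `|l i - l j|² / 2`, with weights `p i * p j ≤ 1` on the left and weights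
one on the right. -/
theorem one_sub_norm_sq_le {l : ι → ℂ} (hl : ∀ j, ‖l j‖ = 1) {p : ι → ℝ}
    (hp : ∀ j, 0 ≤ p j) (hp1 : ∑ j, p j = 1) :
    1 - ‖∑ j, (p j : ℂ) * l j‖ ^ 2 ≤ (Fintype.card ι : ℝ) ^ 2 - ‖∑ j, l j‖ ^ 2 := by
  have h1 := norm_sum_mul_sq_eq hl p
  have h2 := norm_sum_mul_sq_eq hl fun _ => 1
  simp only [Complex.ofReal_one, one_mul, Finset.sum_const, Finset.card_univ, nsmul_eq_mul,
    mul_one] at h2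
  rw [h1, h2, hp1, one_pow, sub_sub_cancel, sub_sub_cancel]
  have hle : ∀ j, p j ≤ 1 := fun j =>
    hp1 ▸ Finset.single_le_sum (fun i _ => hp i) (Finset.mem_univ j)
  refine Finset.sum_le_sum fun i _ => Finset.sum_le_sum fun j _ => ?_
  exact mul_le_of_le_one_left (by positivity) (mul_le_one₀ (hle i) (hp j) (hle j))

end Geometry

/-! ### Reduction of the diamond distance to eigenvalues -/

open scoped Kronecker

theorem ampl_conjMap {d k : ℕ} (X : Matrix (Fin d) (Fin d) ℂ)
    (ρ : Matrix (Fin d × Fin k) (Fin d × Fin k) ℂ) :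
    ampl (conjMap X) k ρ =
      (X ⊗ₖ (1 : Matrix (Fin k) (Fin k) ℂ)) * ρ * (X ⊗ₖ (1 : Matrix (Fin k) (Fin k) ℂ))ᴴ := by
  ext ⟨i, a⟩ ⟨j, b⟩
  simp [ampl, conjMap, Matrix.mul_apply, Matrix.kroneckerMap_apply, Fintype.sum_prod_type,
    Matrix.one_apply, Finset.sum_mul, apply_ite]

theorem ampl_id {d k : ℕ} (ρ : Matrix (Fin d × Fin k) (Fin d × Fin k) ℂ) :
    ampl LinearMap.id k ρ = ρ := rfl

theorem kronecker_one_mem_unitaryGroup {d k : ℕ} {X : Matrix (Fin d) (Fin d) ℂ}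
    (hX : X ∈ Matrix.unitaryGroup (Fin d) ℂ) :
    X ⊗ₖ (1 : Matrix (Fin k) (Fin k) ℂ) ∈ Matrix.unitaryGroup (Fin d × Fin k) ℂ := by
  rw [Matrix.mem_unitaryGroup_iff, Matrix.star_eq_conjTranspose, Matrix.conjTranspose_kronecker,
    ← Matrix.mul_kronecker_mul, ← Matrix.star_eq_conjTranspose, Matrix.mem_unitaryGroup_iff.mp hX]
  simp

/-- The expectation of `X ⊗ 1` in a state is a convex combination of the eigenvalues of `X`. -/
theorem exists_trace_kronecker_one_mul_eq {d k : ℕ} {W : Matrix (Fin d) (Fin d) ℂ}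
    (hW : W ∈ Matrix.unitaryGroup (Fin d) ℂ) (l : Fin d → ℂ)
    {ρ : Matrix (Fin d × Fin k) (Fin d × Fin k) ℂ} (hρ : IsDensity ρ) :
    ∃ p : Fin d → ℝ, (∀ j, 0 ≤ p j) ∧ ∑ j, p j = 1 ∧
      (((W * Matrix.diagonal l * Wᴴ) ⊗ₖ (1 : Matrix (Fin k) (Fin k) ℂ)) * ρ).trace =
        ∑ j, (p j : ℂ) * l j := by
  set V := W ⊗ₖ (1 : Matrix (Fin k) (Fin k) ℂ) with hV
  have hVu : V * Vᴴ = 1 := Matrix.mem_unitaryGroup_iff.mp (kronecker_one_mem_unitaryGroup hW)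
  set σ := Vᴴ * ρ * V with hσ
  have hσp : σ.PosSemidef := hρ.1.conjTranspose_mul_mul_same V
  have hdiag : ∀ i, 0 ≤ (σ i i).re ∧ (((σ i i).re : ℝ) : ℂ) = σ i i := fun i => by
    have h := Complex.nonneg_iff.mp (hσp.diag_nonneg (i := i))
    exact ⟨h.1, Complex.ext rfl (by simpa using h.2)⟩
  have hp : ∀ j, ((∑ a, (σ (j, a) (j, a)).re : ℝ) : ℂ) = ∑ a, σ (j, a) (j, a) := fun j => by
    rw [Complex.ofReal_sum]
    exact Finset.sum_congr rfl fun a _ => (hdiag _).2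
  -- The weights are the populations of the reduced system state in the eigenbasis of `X`.
  refine ⟨fun j => ∑ a, (σ (j, a) (j, a)).re,
    fun j => Finset.sum_nonneg fun a _ => (hdiag _).1, ?_, ?_⟩
  · have h : σ.trace = 1 := by
      rw [hσ, Matrix.trace_mul_comm, ← Matrix.mul_assoc, hVu, Matrix.one_mul, hρ.2]
    rw [Matrix.trace, Fintype.sum_prod_type] at h
    apply Complex.ofReal_injective
    rw [Complex.ofReal_sum, Complex.ofReal_one, ← h]
    exact Finset.sum_congr rfl fun j _ => hp j
  · have h : ((W * Matrix.diagonal l * Wᴴ) ⊗ₖ (1 : Matrix (Fin k) (Fin k) ℂ)) =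
        V * (Matrix.diagonal l ⊗ₖ (1 : Matrix (Fin k) (Fin k) ℂ)) * Vᴴ := by
      rw [hV, Matrix.conjTranspose_kronecker, ← Matrix.mul_kronecker_mul,
        ← Matrix.mul_kronecker_mul]
      simp
    have h2 : (V * (Matrix.diagonal l ⊗ₖ (1 : Matrix (Fin k) (Fin k) ℂ)) * Vᴴ * ρ).trace =
        ((Matrix.diagonal l ⊗ₖ (1 : Matrix (Fin k) (Fin k) ℂ)) * σ).trace := by
      rw [hσ, Matrix.mul_assoc, Matrix.mul_assoc, Matrix.trace_mul_comm]
      simp only [Matrix.mul_assoc]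
    rw [h, h2, ← Matrix.diagonal_one, Matrix.diagonal_kronecker_diagonal, Matrix.trace,
      Fintype.sum_prod_type]
    refine Finset.sum_congr rfl fun j _ => ?_
    rw [hp, Finset.sum_mul]
    refine Finset.sum_congr rfl fun a _ => ?_
    simp [Matrix.diagonal_mul, mul_comm]

/-- The diamond distance of a unitary channel from the identity is controlled by the smallest norm
of a convex combination of the eigenvalues. -/
theorem diamondDist_conjMap_le {d : ℕ} {W : Matrix (Fin d) (Fin d) ℂ}
    (hW : W ∈ Matrix.unitaryGroup (Fin d) ℂ) {l : Fin d → ℂ}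
    (hX : W * Matrix.diagonal l * Wᴴ ∈ Matrix.unitaryGroup (Fin d) ℂ) {B : ℝ} (hB0 : 0 ≤ B)
    (hB : ∀ p : Fin d → ℝ, (∀ j, 0 ≤ p j) → ∑ j, p j = 1 →
      √(1 - ‖∑ j, (p j : ℂ) * l j‖ ^ 2) ≤ B) :
    diamondDist (conjMap (W * Matrix.diagonal l * Wᴴ)) LinearMap.id ≤ B := by
  have h : sSup {t : ℝ | ∃ ρ : Matrix (Fin d × Fin d) (Fin d × Fin d) ℂ,
      IsDensity ρ ∧ t = traceNorm (ampl (conjMap (W * Matrix.diagonal l * Wᴴ)) d ρ -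
        ampl LinearMap.id d ρ)} ≤ 2 * B := by
    -- Nonnegativity of the bound covers the default value `sSup ∅ = 0`.
    apply Real.sSup_le _ (by positivity)
    rintro t ⟨ρ, hρ, rfl⟩
    obtain ⟨p, hp0, hp1, hp⟩ := exists_trace_kronecker_one_mul_eq hW l hρ
    rw [ampl_conjMap, ampl_id]
    refine (traceNorm_unitary_conj_sub_le (kronecker_one_mem_unitaryGroup hX) hρ).trans ?_
    rw [hp]
    exact mul_le_mul_of_nonneg_left (hB p hp0 hp1) zero_le_two
  unfold diamondDist
  linarith

/-! ### Sphere averages as ratios of Gaussian integrals -/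

section PolarCoordinates

open Set Metric Measure

variable {E : Type*} [NormedAddCommGroup E] [NormedSpace ℝ E] [MeasurableSpace E]
  [Nontrivial E] (μ : Measure E) [FiniteDimensional ℝ E] [BorelSpace E] [μ.IsAddHaarMeasure]

/-- In polar coordinates the radial factor depends only on the degree `k`, so it cancels when `g` is
compared with `‖x‖ ^ k`. -/
theorem integral_homogeneous_mul_exp_neg_norm_sq {g : E → ℝ} {k : ℕ}
    (hg : ∀ (r : ℝ) (x : E), 0 < r → g (r • x) = r ^ k * g x) :
    ∫ x, g x * Real.exp (-‖x‖ ^ 2) ∂μ = (∫ ψ : sphere (0 : E) 1, g ψ ∂μ.toSphere) *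
      ∫ r : Ioi (0 : ℝ), (r : ℝ) ^ k * Real.exp (-(r : ℝ) ^ 2)
        ∂(volumeIoiPow (Module.finrank ℝ E - 1)) := by
  have h1 : ∫ x, g x * Real.exp (-‖x‖ ^ 2) ∂μ =
      ∫ x : ({(0)}ᶜ : Set E), g x.1 * Real.exp (-‖x.1‖ ^ 2) ∂(μ.comap (↑)) := by
    rw [integral_subtype_comap (measurableSet_singleton _).compl
      fun x ↦ g x * Real.exp (-‖x‖ ^ 2), restrict_compl_singleton]
  have h2 := μ.measurePreserving_homeomorphUnitSphereProd.integral_comp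
    (Homeomorph.measurableEmbedding _)
    (fun y => g (y.1 : E) * ((y.2 : ℝ) ^ k * Real.exp (-(y.2 : ℝ) ^ 2)))
  rw [h1, ← integral_prod_mul, ← h2]
  refine integral_congr_ae (Filter.Eventually.of_forall fun x => ?_)
  have hx : 0 < ‖(x : E)‖ := norm_pos_iff.mpr x.2
  have h3 := hg ‖(x : E)‖ (‖(x : E)‖⁻¹ • (x : E)) hx
  rw [smul_inv_smul₀ hx.ne'] at h3
  simp only [homeomorphUnitSphereProd_apply_snd_coe, homeomorphUnitSphereProd_apply_fst_coe]
  rw [h3]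
  ring

theorem average_toSphere_eq_div {g : E → ℝ} {k : ℕ}
    (hg : ∀ (r : ℝ) (x : E), 0 < r → g (r • x) = r ^ k * g x)
    (h0 : ∫ x, ‖x‖ ^ k * Real.exp (-‖x‖ ^ 2) ∂μ ≠ 0) :
    ⨍ ψ : sphere (0 : E) 1, g ψ ∂μ.toSphere =
      (∫ x, g x * Real.exp (-‖x‖ ^ 2) ∂μ) / ∫ x, ‖x‖ ^ k * Real.exp (-‖x‖ ^ 2) ∂μ := by
  have hn : ∀ (r : ℝ) (x : E), 0 < r → ‖r • x‖ ^ k = r ^ k * ‖x‖ ^ k := fun r x hr => by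
    rw [norm_smul, Real.norm_of_nonneg hr.le, mul_pow]
  have h1 := integral_homogeneous_mul_exp_neg_norm_sq μ (g := fun x => ‖x‖ ^ k) hn
  rw [h1] at h0
  rw [h1, integral_homogeneous_mul_exp_neg_norm_sq μ hg, average_eq,
    mul_div_mul_right _ _ (right_ne_zero_of_mul h0)]
  have h2 : ∫ ψ : sphere (0 : E) 1, ‖(ψ : E)‖ ^ k ∂μ.toSphere = μ.toSphere.real univ := by
    simp
  rw [h2, smul_eq_mul, inv_mul_eq_div]

omit [Nontrivial E] in
-- By uniqueness of Haar measure the pushforward is a multiple of `μ`; the unit ball is preserved,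
-- so the factor is one.
theorem measurePreserving_linearIsometryEquiv (e : E ≃ₗᵢ[ℝ] E) : MeasurePreserving e μ μ := by
  refine ⟨e.continuous.measurable, ?_⟩
  have : (μ.map e).IsAddHaarMeasure := e.toContinuousLinearEquiv.isAddHaarMeasure_map μ
  rw [isAddLeftInvariant_eq_smul (μ.map e) μ]
  have hb : (μ.map e) (ball 0 1) = μ (ball 0 1) := by
    rw [map_apply e.continuous.measurable measurableSet_ball]
    congr 1
    ext x
    simp
  rw [isAddLeftInvariant_eq_smul (μ.map e) μ] at hb
  have hpos : μ (ball (0 : E) 1) ≠ 0 := (measure_ball_pos μ _ one_pos).ne'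
  have hfin : μ (ball (0 : E) 1) ≠ ⊤ := measure_ball_lt_top.ne
  have hc : addHaarScalarFactor (μ.map e) μ = 1 := by
    have h2 : (addHaarScalarFactor (μ.map e) μ : ENNReal) * μ (ball 0 1) =
      1 * μ (ball 0 1) := by simpa using hb
    exact_mod_cast (ENNReal.mul_left_inj hpos hfin).mp h2
  rw [hc, one_smul]

end PolarCoordinates

/-! ### Gaussian moments of diagonal forms -/

section GaussianMoments

open scoped Nat

/-- Lebesgue measure on `ℂ^d` with its Euclidean norm. -/
abbrev euclideanMeasure (d : ℕ) : Measure (EuclideanSpace ℂ (Fin d)) :=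
  (volume : Measure (Fin d → ℂ)).map (WithLp.toLp 2)

instance (d : ℕ) : (euclideanMeasure d).IsAddHaarMeasure :=
  (PiLp.continuousLinearEquiv 2 ℂ fun _ : Fin d => ℂ).symm.isAddHaarMeasure_map volume

theorem integral_pow_mul_exp_neg_norm_sq (m : ℕ) :
    ∫ z : ℂ, (‖z‖ ^ 2) ^ m * Real.exp (-‖z‖ ^ 2) = Real.pi * m ! := by
  have h := Complex.integral_rpow_mul_exp_neg_rpow (p := 2) (q := 2 * m) one_le_two
    (by have : (0 : ℝ) ≤ m := Nat.cast_nonneg m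
        linarith)
  rw [show ((2 : ℝ) * m + 2) / 2 = m + 1 by ring, Real.Gamma_nat_eq_factorial,
    show 2 * Real.pi / 2 = Real.pi by ring] at h
  rw [← h]
  refine integral_congr_ae (Filter.Eventually.of_forall fun z => ?_)
  simp only
  rw [← pow_mul]
  norm_cast

variable {d : ℕ}

/-- The Gaussian-weighted monomial `∏_{j ∈ s} |x_j|²`. -/
def gaussMonomial (s : Multiset (Fin d)) (x : EuclideanSpace ℂ (Fin d)) : ℝ :=
  (s.map fun j => ‖x j‖ ^ 2).prod * Real.exp (-‖x‖ ^ 2)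

theorem gaussMonomial_toLp (s : Multiset (Fin d)) (y : Fin d → ℂ) :
    gaussMonomial s (WithLp.toLp 2 y) =
      ∏ j, (‖y j‖ ^ 2) ^ s.count j * Real.exp (-‖y j‖ ^ 2) := by
  rw [gaussMonomial, Finset.prod_mul_distrib, ← Real.exp_sum, EuclideanSpace.norm_sq_eq,
    Finset.sum_neg_distrib, Finset.prod_multiset_map_count]
  congr 1
  refine Finset.prod_subset (Finset.subset_univ _) fun j _ hj => ?_
  rw [Multiset.count_eq_zero_of_notMem (by simpa using hj), pow_zero]

theorem measurableEmbedding_toLp :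
    MeasurableEmbedding (WithLp.toLp 2 : (Fin d → ℂ) → EuclideanSpace ℂ (Fin d)) :=
  (PiLp.continuousLinearEquiv 2 ℂ fun _ : Fin d => ℂ).symm.toHomeomorph.measurableEmbedding

theorem integral_gaussMonomial (s : Multiset (Fin d)) :
    ∫ x, gaussMonomial s x ∂(euclideanMeasure d) = Real.pi ^ d * ∏ j, (s.count j)! := by
  rw [measurableEmbedding_toLp.integral_map]
  simp_rw [gaussMonomial_toLp]
  rw [integral_fintype_prod_volume_eq_prod
    (fun j (z : ℂ) => (‖z‖ ^ 2) ^ s.count j * Real.exp (-‖z‖ ^ 2))]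
  simp_rw [integral_pow_mul_exp_neg_norm_sq]
  rw [Finset.prod_mul_distrib]
  simp

/-- A non-integrable function has integral zero by convention, whereas this integral is positive. -/
theorem integrable_gaussMonomial (s : Multiset (Fin d)) :
    Integrable (gaussMonomial s) (euclideanMeasure d) := by
  by_contra h
  have h1 := integral_gaussMonomial s
  rw [integral_undef h] at h1
  have : 0 < Real.pi ^ d * ∏ j, ((s.count j)! : ℝ) := by positivity
  exact absurd h1 (by push_cast; exact this.ne)

theorem integral_sum_gaussMonomial {κ : Type*} [Fintype κ] (c : κ → ℂ)
    (s : κ → Multiset (Fin d)) :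
    ∫ x, ∑ i, c i * (gaussMonomial (s i) x : ℂ) ∂(euclideanMeasure d) =
      Real.pi ^ d * ∑ i, c i * ((∏ j, ((s i).count j)! : ℕ) : ℂ) := by
  rw [integral_finsetSum _ fun i _ => (integrable_gaussMonomial (s i)).ofReal.const_mul _,
    Finset.mul_sum]
  refine Finset.sum_congr rfl fun i _ => ?_
  rw [integral_const_mul, integral_complex_ofReal, integral_gaussMonomial]
  push_cast
  ring

/-- Peeling off one index at a time turns the factorial moments into products of sums `1 +
(indicators)`, the weights in `sum_quartic_weights`. -/
theorem prod_factorial_count_cons (i : Fin d) (s : Multiset (Fin d)) :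
    ∏ j, ((i ::ₘ s).count j)! = (s.count i + 1) * ∏ j, (s.count j)! := by
  rw [← Finset.mul_prod_erase _ _ (Finset.mem_univ i),
    ← Finset.mul_prod_erase _ (fun j => (s.count j)!) (Finset.mem_univ i),
    Multiset.count_cons_self, Nat.factorial_succ, mul_assoc]
  congr 2
  exact Finset.prod_congr rfl fun j hj => by
    rw [Multiset.count_cons_of_ne (Finset.ne_of_mem_erase hj)]

/-- The squared modulus of the diagonal quadratic form with entries `l`. -/
def diagForm (l : Fin d → ℂ) (x : EuclideanSpace ℂ (Fin d)) : ℝ :=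
  Complex.normSq (∑ j, l j * (‖x j‖ ^ 2 : ℝ))

theorem ofReal_diagForm (l : Fin d → ℂ) (x : EuclideanSpace ℂ (Fin d)) :
    (diagForm l x : ℂ) =
      (∑ j, l j * (‖x j‖ ^ 2 : ℝ)) * ∑ j, star (l j) * (‖x j‖ ^ 2 : ℝ) := by
  rw [diagForm, ← Complex.mul_conj, map_sum]
  simp

theorem integral_diagForm (l : Fin d → ℂ) :
    ((∫ x, diagForm l x * Real.exp (-‖x‖ ^ 2) ∂(euclideanMeasure d) : ℝ) : ℂ) =
      Real.pi ^ d * ((∑ j, l j) * (∑ j, star (l j)) + ∑ j, l j * star (l j)) := by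
  have h1 : ∀ x : EuclideanSpace ℂ (Fin d), ((diagForm l x * Real.exp (-‖x‖ ^ 2) : ℝ) : ℂ) =
      ∑ i : Fin d × Fin d, (l i.1 * star (l i.2)) * (gaussMonomial {i.1, i.2} x : ℂ) := by
    intro x
    rw [Complex.ofReal_mul, ofReal_diagForm, Finset.sum_mul_sum, Fintype.sum_prod_type,
      Finset.sum_mul]
    refine Finset.sum_congr rfl fun i _ => ?_
    rw [Finset.sum_mul]
    refine Finset.sum_congr rfl fun j _ => ?_
    simp [gaussMonomial]
    ring
  rw [← integral_complex_ofReal]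
  simp_rw [h1]
  rw [integral_sum_gaussMonomial]
  congr 1
  simp only [Multiset.insert_eq_cons, ← Multiset.cons_zero, prod_factorial_count_cons]
  simp [Fintype.sum_prod_type, Multiset.count_singleton, mul_add, Finset.sum_add_distrib,
    Finset.sum_mul_sum]
  ring

theorem sum_mul_one_add_ite {ι : Type*} [Fintype ι] [DecidableEq ι] (f : ι → ℂ) (i : ι) :
    ∑ j, f j * (1 + if j = i then 1 else 0) = ∑ j, f j + f i := by
  simp [mul_add, Finset.sum_add_distrib]

/-- The sum over the permutation group `S₄` of products of traces, for a unitary with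
eigenvalues `a`. -/
theorem sum_quartic_weights {ι : Type*} [Fintype ι] [DecidableEq ι] {a b : ι → ℂ}
    (hab : ∀ j, b j * a j = 1) :
    ∑ i, ∑ j, ∑ k, ∑ m, (b i * (b j * (a k * a m))) *
      (((1 + (if m = k then 1 else 0) + (if m = j then 1 else 0) + (if m = i then 1 else 0)) *
        ((1 + (if k = j then 1 else 0) + (if k = i then 1 else 0)) *
          (1 + (if j = i then 1 else 0)))) : ℂ) =
      ((∑ j, a j) ^ 2 + ∑ j, a j ^ 2) * ((∑ j, b j) ^ 2 + ∑ j, b j ^ 2) +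
        4 * (Fintype.card ι + 2) * ((∑ j, a j) * ∑ j, b j) +
        2 * Fintype.card ι * (Fintype.card ι + 3) := by
  set A := ∑ j, a j with hA
  set A₂ := ∑ j, a j ^ 2 with hA₂
  set B := ∑ j, b j with hB
  -- The sums are evaluated from the inside out. The relation `b j * a j = 1` enters only at the sum
  -- over `j`, in `h3`.
  have h1 : ∀ i j k, ∑ m, (b i * (b j * (a k * a m))) *
      (((1 + (if m = k then 1 else 0) + (if m = j then 1 else 0) + (if m = i then 1 else 0)) *
        ((1 + (if k = j then 1 else 0) + (if k = i then 1 else 0)) *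
          (1 + (if j = i then 1 else 0)))) : ℂ) =
      b i * (b j * (1 + (if j = i then 1 else 0))) *
        (a k * (A + a k + a j + a i) * (1 + (if k = j then 1 else 0) + (if k = i then 1 else 0))) := by
    intro i j k
    have : A + a k + a j + a i = ∑ m, a m *
        (1 + (if m = k then 1 else 0) + (if m = j then 1 else 0) + (if m = i then 1 else 0)) := by
      simp [mul_add, Finset.sum_add_distrib, hA]
    rw [this]
    simp only [Finset.mul_sum, Finset.sum_mul]
    exact Finset.sum_congr rfl fun m _ => by ring
  have h2 : ∀ i j, ∑ k, (a k * (A + a k + a j + a i) *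
      (1 + (if k = j then 1 else 0) + (if k = i then 1 else 0))) =
      A ^ 2 + A₂ + 2 * A * (a i + a j) + 2 * a i ^ 2 + 2 * a j ^ 2 + 2 * a i * a j := by
    intro i j
    have : ∑ k, a k * (A + a k + a j + a i) = A ^ 2 + A₂ + A * (a i + a j) := by
      have : ∀ k, a k * (A + a k + a j + a i) = a k * (A + a j + a i) + a k ^ 2 := fun k => by ring
      simp only [this, Finset.sum_add_distrib, ← Finset.sum_mul]
      rw [← hA, ← hA₂]
      ring
    simp only [mul_add (_ * _), Finset.sum_add_distrib, mul_one, this, mul_ite, mul_zero,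
      Finset.sum_ite_eq', Finset.mem_univ, if_true]
    ring
  have h3 : ∀ i, ∑ j, b i * (b j * (1 + (if j = i then 1 else 0))) *
      (A ^ 2 + A₂ + 2 * A * (a i + a j) + 2 * a i ^ 2 + 2 * a j ^ 2 + 2 * a i * a j) =
      b i * (B * (A ^ 2 + A₂) + 2 * A * (Fintype.card ι + 1)) + 2 * A * B + 2 * a i * B +
        2 * (Fintype.card ι : ℂ) + b i ^ 2 * (A ^ 2 + A₂) + 4 * A * b i + 6 := by
    intro i
    have e : ∀ j, b i * (b j * (1 + (if j = i then 1 else 0))) *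
      (A ^ 2 + A₂ + 2 * A * (a i + a j) + 2 * a i ^ 2 + 2 * a j ^ 2 + 2 * a i * a j) =
      ((b i * (A ^ 2 + A₂) + 2 * A + 2 * a i) * b j + (b i * 2 * A + 2) + 2 * b i * a j) *
      (1 + (if j = i then 1 else 0)) := fun j => by
        linear_combination (1 + (if j = i then (1 : ℂ) else 0)) *
          ((2 * A * b j + 2 * a i * b j + 2 * b j * a j) * hab i +
            (b i * 2 * A + 2 * b i * a j + 2) * hab j)
    simp only [e, sum_mul_one_add_ite, Finset.sum_add_distrib, ← Finset.mul_sum,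
      Finset.sum_const, Finset.card_univ, nsmul_eq_mul]
    rw [← hB, ← hA]
    linear_combination 4 * hab i
  simp only [h1, ← Finset.mul_sum, h2, h3, Finset.sum_add_distrib, ← Finset.sum_mul,
    Finset.sum_const, Finset.card_univ, nsmul_eq_mul]
  rw [← hB, ← hA]
  ring

theorem integral_diagForm_sq {l : Fin d → ℂ} (hl : ∀ j, star (l j) * l j = 1) :
    ((∫ x, diagForm l x ^ 2 * Real.exp (-‖x‖ ^ 2) ∂(euclideanMeasure d) : ℝ) : ℂ) =
      Real.pi ^ d * (((∑ j, l j) ^ 2 + ∑ j, l j ^ 2) *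
          ((∑ j, star (l j)) ^ 2 + ∑ j, star (l j) ^ 2) +
        4 * (d + 2) * ((∑ j, l j) * ∑ j, star (l j)) + 2 * d * (d + 3)) := by
  have h1 : ∀ x : EuclideanSpace ℂ (Fin d), ((diagForm l x ^ 2 * Real.exp (-‖x‖ ^ 2) : ℝ) : ℂ) =
      ∑ i : Fin d × Fin d × Fin d × Fin d, (star (l i.1) * (star (l i.2.1) *
        (l i.2.2.1 * l i.2.2.2))) *
        (gaussMonomial {i.2.2.2, i.2.2.1, i.2.1, i.1} x : ℂ) := by
    intro x
    rw [Complex.ofReal_mul, Complex.ofReal_pow, ofReal_diagForm]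
    simp only [Fintype.sum_prod_type]
    -- The conjugated factors come first, matching the order of indices in `sum_quartic_weights`.
    rw [show ∀ a b : ℂ, (a * b) ^ 2 = b * (b * (a * a)) by intros; ring]
    simp only [Finset.sum_mul]
    refine Finset.sum_congr rfl fun i _ => ?_
    simp only [Finset.mul_sum, Finset.sum_mul]
    refine Finset.sum_congr rfl fun j _ => ?_
    refine Finset.sum_congr rfl fun k _ => ?_
    refine Finset.sum_congr rfl fun m _ => ?_
    simp [gaussMonomial]
    ring
  rw [← integral_complex_ofReal]
  simp_rw [h1]
  rw [integral_sum_gaussMonomial]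
  congr 1
  simp only [Multiset.insert_eq_cons, ← Multiset.cons_zero, prod_factorial_count_cons]
  have h2 := sum_quartic_weights hl
  rw [Fintype.card_fin] at h2
  rw [← h2]
  simp only [Fintype.sum_prod_type, Multiset.count_cons, Multiset.count_zero]
  refine Finset.sum_congr rfl fun i _ => Finset.sum_congr rfl fun j _ =>
    Finset.sum_congr rfl fun k _ => Finset.sum_congr rfl fun m _ => ?_
  congr 1
  simp
  ring

end GaussianMoments

/-! ### Haar moments of a unitary error -/

variable {d : ℕ}

theorem diagForm_smul (l : Fin d → ℂ) (r : ℝ) (x : EuclideanSpace ℂ (Fin d)) :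
    diagForm l (r • x) = r ^ 4 * diagForm l x := by
  have h : ∑ j, l j * ((‖(r • x) j‖ ^ 2 : ℝ) : ℂ) =
      ((r ^ 2 : ℝ) : ℂ) * ∑ j, l j * (‖x j‖ ^ 2 : ℝ) := by
    rw [Finset.mul_sum]
    refine Finset.sum_congr rfl fun j _ => ?_
    rw [PiLp.smul_apply, norm_smul, mul_pow, Real.norm_eq_abs, sq_abs]
    push_cast
    ring
  rw [diagForm, h, Complex.normSq_mul, Complex.normSq_ofReal, diagForm]
  ring

/-- With all eigenvalues one, the same moment formulas give the normalizing denominators of the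
averages. -/
theorem diagForm_one (x : EuclideanSpace ℂ (Fin d)) : diagForm (fun _ => 1) x = ‖x‖ ^ 4 := by
  rw [diagForm]
  simp only [one_mul]
  rw [← Complex.ofReal_sum, Complex.normSq_ofReal, ← EuclideanSpace.norm_sq_eq]
  ring

theorem integral_norm_pow_four :
    ∫ x, ‖x‖ ^ 4 * Real.exp (-‖x‖ ^ 2) ∂(euclideanMeasure d) = Real.pi ^ d * (d * (d + 1)) := by
  have h := integral_diagForm (d := d) fun _ => 1
  simp only [diagForm_one] at h
  apply Complex.ofReal_injective
  rw [h]
  simp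
  ring_nf

theorem integral_norm_pow_eight :
    ∫ x, ‖x‖ ^ 8 * Real.exp (-‖x‖ ^ 2) ∂(euclideanMeasure d) =
      Real.pi ^ d * (d * (d + 1) * (d + 2) * (d + 3)) := by
  have h := integral_diagForm_sq (d := d) (l := fun _ => 1) (by simp)
  simp only [diagForm_one, ← pow_mul] at h
  apply Complex.ofReal_injective
  rw [h]
  simp
  ring

theorem haarAvg_eq_div (hd : 0 < d) {g : EuclideanSpace ℂ (Fin d) → ℝ} {k : ℕ}
    (hg : ∀ (r : ℝ) x, g (r • x) = r ^ k * g x)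
    (h0 : ∫ x, ‖x‖ ^ k * Real.exp (-‖x‖ ^ 2) ∂(euclideanMeasure d) ≠ 0) :
    haarAvg d (fun ψ => g ψ) =
      (∫ x, g x * Real.exp (-‖x‖ ^ 2) ∂(euclideanMeasure d)) /
        ∫ x, ‖x‖ ^ k * Real.exp (-‖x‖ ^ 2) ∂(euclideanMeasure d) := by
  have : Nonempty (Fin d) := ⟨⟨0, hd⟩⟩
  exact average_toSphere_eq_div (euclideanMeasure d) (fun r x _ => hg r x) h0

theorem haarAvg_const (hd : 0 < d) (c : ℝ) : haarAvg d (fun _ => c) = c := by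
  have : Nonempty (Fin d) := ⟨⟨0, hd⟩⟩
  have : NeZero (sphereMeasure d) := ⟨(euclideanMeasure d).toSphere_ne_zero⟩
  have : IsFiniteMeasure (sphereMeasure d) :=
    inferInstanceAs (IsFiniteMeasure (euclideanMeasure d).toSphere)
  exact average_const _ c

/-- The isometry of `ℂ^d` given by a unitary matrix. -/
def unitaryIsometry {W : Matrix (Fin d) (Fin d) ℂ} (hW : W ∈ Matrix.unitaryGroup (Fin d) ℂ) :
    EuclideanSpace ℂ (Fin d) ≃ₗᵢ[ℝ] EuclideanSpace ℂ (Fin d) :=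
  LinearIsometry.toLinearIsometryEquiv
    { toLinearMap := (Matrix.toEuclideanLin W).restrictScalars ℝ
      norm_map' := fun x => by
        have h : inner ℂ (Matrix.toEuclideanLin W x) (Matrix.toEuclideanLin W x) =
            inner ℂ x x := by
          rw [← LinearMap.adjoint_inner_right, ← Matrix.toEuclideanLin_conjTranspose_eq_adjoint]
          congr 1
          rw [Matrix.toLpLin_apply, Matrix.toLpLin_apply]
          simp only [Matrix.mulVec_mulVec]
          rw [← Matrix.star_eq_conjTranspose, Matrix.mem_unitaryGroup_iff'.mp hW,
            Matrix.one_mulVec]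
        rw [inner_self_eq_norm_sq_to_K, inner_self_eq_norm_sq_to_K] at h
        have h' : ‖Matrix.toEuclideanLin W x‖ ^ 2 = ‖x‖ ^ 2 := by exact_mod_cast h
        exact (pow_left_inj₀ (norm_nonneg _) (norm_nonneg _) two_ne_zero).mp h' } rfl

theorem unitaryIsometry_apply {W : Matrix (Fin d) (Fin d) ℂ}
    (hW : W ∈ Matrix.unitaryGroup (Fin d) ℂ) (x : EuclideanSpace ℂ (Fin d)) (i : Fin d) :
    unitaryIsometry hW x i = ∑ j, W i j * x j := rfl

theorem conjTranspose_mem_unitaryGroup {W : Matrix (Fin d) (Fin d) ℂ}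
    (hW : W ∈ Matrix.unitaryGroup (Fin d) ℂ) : Wᴴ ∈ Matrix.unitaryGroup (Fin d) ℂ :=
  Unitary.star_mem hW

theorem integral_comp_unitaryIsometry {W : Matrix (Fin d) (Fin d) ℂ}
    (hW : W ∈ Matrix.unitaryGroup (Fin d) ℂ) (g : EuclideanSpace ℂ (Fin d) → ℝ) :
    ∫ x, g (unitaryIsometry hW x) * Real.exp (-‖x‖ ^ 2) ∂(euclideanMeasure d) =
      ∫ x, g x * Real.exp (-‖x‖ ^ 2) ∂(euclideanMeasure d) := by
  have h := (measurePreserving_linearIsometryEquiv (euclideanMeasure d)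
    (unitaryIsometry hW)).integral_comp (unitaryIsometry hW).toHomeomorph.measurableEmbedding
    fun x => g x * Real.exp (-‖x‖ ^ 2)
  simpa only [LinearIsometryEquiv.norm_map] using h

theorem stateFid_conjMap_eq_normSq (X : Matrix (Fin d) (Fin d) ℂ) (ψ : UnitVec d) :
    stateFid (conjMap X) ψ = Complex.normSq (∑ i, ∑ j, star (ψ.1 i) * X i j * ψ.1 j) := by
  have h : ∑ i, ∑ j, star (ψ.1 i) * conjMap X (proj ψ) i j * ψ.1 j =
      ((Complex.normSq (∑ i, ∑ j, star (ψ.1 i) * X i j * ψ.1 j) : ℝ) : ℂ) := by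
    have e : ∀ i j, conjMap X (proj ψ) i j =
        (∑ k, X i k * ψ.1 k) * star (∑ k, X j k * ψ.1 k) := by
      intro i j
      have : proj ψ = Matrix.vecMulVec (fun i => ψ.1 i) (fun i => star (ψ.1 i)) := rfl
      change (X * proj ψ * Xᴴ) i j = _
      rw [this, Matrix.mul_vecMulVec, Matrix.vecMulVec_mul, Matrix.vecMulVec_apply]
      simp [Matrix.mulVec, Matrix.vecMul, dotProduct, mul_comm]
    rw [← Complex.mul_conj, map_sum, Finset.sum_mul_sum]
    refine Finset.sum_congr rfl fun i _ => Finset.sum_congr rfl fun j _ => ?_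
    rw [e]
    simp only [mul_assoc, ← Finset.mul_sum]
    rw [map_mul, Complex.star_def, Complex.conj_conj]
    ring
  rw [stateFid, h, Complex.ofReal_re]

/-- In the eigenbasis `⟨ψ|X|ψ⟩ = ∑ l k * |(Wᴴψ) k|²`; the rotation by `Wᴴ` then disappears under the
invariant average. -/
theorem stateFid_conjMap {W : Matrix (Fin d) (Fin d) ℂ} (hW : W ∈ Matrix.unitaryGroup (Fin d) ℂ)
    (l : Fin d → ℂ) (ψ : UnitVec d) :
    stateFid (conjMap (W * Matrix.diagonal l * Wᴴ)) ψ =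
      diagForm l (unitaryIsometry (conjTranspose_mem_unitaryGroup hW) ψ) := by
  rw [stateFid_conjMap_eq_normSq, diagForm]
  congr 1
  have e : ∀ k, ((‖unitaryIsometry (conjTranspose_mem_unitaryGroup hW) ψ.1 k‖ ^ 2 : ℝ) : ℂ) =
      ∑ i, ∑ j, star (ψ.1 i) * W i k * (star (W j k) * ψ.1 j) := by
    intro k
    rw [← Complex.normSq_eq_norm_sq, ← Complex.mul_conj, unitaryIsometry_apply, map_sum,
      Finset.sum_mul_sum, Finset.sum_comm]
    refine Finset.sum_congr rfl fun i _ => Finset.sum_congr rfl fun j _ => ?_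
    simp
    ring
  simp only [e, Finset.mul_sum]
  rw [Finset.sum_comm]
  conv_rhs => rw [Finset.sum_comm]; enter [2, i]; rw [Finset.sum_comm]
  rw [Finset.sum_comm]
  refine Finset.sum_congr rfl fun i _ => Finset.sum_congr rfl fun j _ => ?_
  rw [Matrix.mul_apply, Finset.mul_sum, Finset.sum_mul]
  refine Finset.sum_congr rfl fun k _ => ?_
  rw [Matrix.mul_diagonal, Matrix.conjTranspose_apply]
  ring

theorem sum_mul_sum_star_eq_norm_sq (l : Fin d → ℂ) :
    (∑ j, l j) * (∑ j, star (l j)) = ((‖∑ j, l j‖ ^ 2 : ℝ) : ℂ) := by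
  rw [← star_sum, Complex.star_def, Complex.mul_conj, Complex.normSq_eq_norm_sq]

/-- The gate fidelity of a unitary error in terms of its eigenvalues. -/
theorem gateFid_conjMap (hd : 0 < d) {W : Matrix (Fin d) (Fin d) ℂ}
    (hW : W ∈ Matrix.unitaryGroup (Fin d) ℂ) {l : Fin d → ℂ} (hl : ∀ j, star (l j) * l j = 1) :
    gateFid (conjMap (W * Matrix.diagonal l * Wᴴ)) = (‖∑ j, l j‖ ^ 2 + d) / (d * (d + 1)) := by
  have hd' : (0 : ℝ) < d := by exact_mod_cast hd
  have hpi : (0 : ℝ) < Real.pi ^ d := by positivity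
  have h1 : gateFid (conjMap (W * Matrix.diagonal l * Wᴴ)) = haarAvg d fun ψ =>
      diagForm l (unitaryIsometry (conjTranspose_mem_unitaryGroup hW) ψ) :=
    congrArg _ (funext (stateFid_conjMap hW l))
  have h2 : ∫ x, diagForm l x * Real.exp (-‖x‖ ^ 2) ∂(euclideanMeasure d) =
      Real.pi ^ d * (‖∑ j, l j‖ ^ 2 + d) := by
    apply Complex.ofReal_injective
    rw [integral_diagForm, sum_mul_sum_star_eq_norm_sq, Finset.sum_congr rfl fun j _ =>
      (mul_comm _ _).trans (hl j)]
    simp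
  rw [h1, haarAvg_eq_div (k := 4) hd (g := fun x => diagForm l (unitaryIsometry _ x))
    (fun r x => by rw [map_smul, diagForm_smul])
    (by rw [integral_norm_pow_four]; positivity),
    integral_comp_unitaryIsometry _ (diagForm l), h2, integral_norm_pow_four,
    mul_div_mul_left _ _ hpi.ne']

/-- The second moment of the state-dependent fidelity of a unitary error in terms of its
eigenvalues. -/
theorem haarAvg_stateFid_sq_conjMap (hd : 0 < d) {W : Matrix (Fin d) (Fin d) ℂ}
    (hW : W ∈ Matrix.unitaryGroup (Fin d) ℂ) {l : Fin d → ℂ} (hl : ∀ j, star (l j) * l j = 1) :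
    haarAvg d (fun ψ => stateFid (conjMap (W * Matrix.diagonal l * Wᴴ)) ψ ^ 2) =
      (‖(∑ j, l j) ^ 2 + ∑ j, l j ^ 2‖ ^ 2 + 4 * (d + 2) * ‖∑ j, l j‖ ^ 2 + 2 * d * (d + 3)) /
        (d * (d + 1) * (d + 2) * (d + 3)) := by
  have hd' : (0 : ℝ) < d := by exact_mod_cast hd
  have hpi : (0 : ℝ) < Real.pi ^ d := by positivity
  have h1 : haarAvg d (fun ψ => stateFid (conjMap (W * Matrix.diagonal l * Wᴴ)) ψ ^ 2) =
      haarAvg d fun ψ =>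
        diagForm l (unitaryIsometry (conjTranspose_mem_unitaryGroup hW) ψ) ^ 2 :=
    congrArg _ (funext fun ψ => by rw [stateFid_conjMap hW l])
  have h2 : ∫ x, diagForm l x ^ 2 * Real.exp (-‖x‖ ^ 2) ∂(euclideanMeasure d) =
      Real.pi ^ d * (‖(∑ j, l j) ^ 2 + ∑ j, l j ^ 2‖ ^ 2 + 4 * (d + 2) * ‖∑ j, l j‖ ^ 2 +
        2 * d * (d + 3)) := by
    apply Complex.ofReal_injective
    have h3 : ((∑ j, l j) ^ 2 + ∑ j, l j ^ 2) *
        ((∑ j, star (l j)) ^ 2 + ∑ j, star (l j) ^ 2) =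
        ((‖(∑ j, l j) ^ 2 + ∑ j, l j ^ 2‖ ^ 2 : ℝ) : ℂ) := by
      rw [← Complex.normSq_eq_norm_sq, ← Complex.mul_conj]
      simp
    rw [integral_diagForm_sq hl, sum_mul_sum_star_eq_norm_sq, h3]
    push_cast
    ring
  rw [h1, haarAvg_eq_div (k := 8) hd (g := fun x => diagForm l (unitaryIsometry _ x) ^ 2)
    (fun r x => by rw [map_smul, diagForm_smul]; ring)
    (by rw [integral_norm_pow_eight]; positivity),
    integral_comp_unitaryIsometry _ (fun x => diagForm l x ^ 2), h2, integral_norm_pow_eight,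
    mul_div_mul_left _ _ hpi.ne']

/-- Unitary errors have unitarity one. -/
theorem unitarity_conjMap (hd : 2 ≤ d) {X : Matrix (Fin d) (Fin d) ℂ}
    (hX : X ∈ Matrix.unitaryGroup (Fin d) ℂ) : unitarity (conjMap X) = 1 := by
  have hd' : (2 : ℝ) ≤ d := by exact_mod_cast hd
  have hX1 : Xᴴ * X = 1 := Matrix.mem_unitaryGroup_iff'.mp hX
  have h : ∀ ψ : UnitVec d, ((conjMap X (proj ψ - (d : ℂ)⁻¹ • 1)) ^ 2).trace.re =
      ((d : ℝ) - 1) / d := by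
    intro ψ
    have hnorm : (∑ i, star (ψ.1 i) * ψ.1 i : ℂ) = 1 := by
      have h1 := EuclideanSpace.norm_sq_eq ψ.1
      rw [mem_sphere_zero_iff_norm.mp ψ.2, one_pow] at h1
      have h2 : (((∑ i, ‖ψ.1 i‖ ^ 2 : ℝ)) : ℂ) = 1 := by rw [← h1, Complex.ofReal_one]
      rw [← h2, Complex.ofReal_sum]
      refine Finset.sum_congr rfl fun i _ => ?_
      rw [mul_comm, Complex.star_def, Complex.mul_conj, Complex.normSq_eq_norm_sq]
    have hproj : proj ψ = Matrix.vecMulVec (fun i => ψ.1 i) (fun i => star (ψ.1 i)) := rfl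
    have hdot : (fun i => star (ψ.1 i)) ⬝ᵥ (fun i => ψ.1 i) = 1 := hnorm
    have hpp : proj ψ * proj ψ = proj ψ := by
      rw [hproj, Matrix.vecMulVec_mul_vecMulVec, hdot, one_smul]
    have htr : (proj ψ).trace = 1 := by
      rw [hproj, Matrix.trace_vecMulVec, dotProduct_comm, hdot]
    -- Unitary conjugation preserves `tr A²`, so the integrand is the constant `1 - 1/d`.
    have hsq : ∀ A : Matrix (Fin d) (Fin d) ℂ, ((conjMap X A) ^ 2).trace = (A * A).trace := by
      intro A
      change ((X * A * Xᴴ) ^ 2).trace = _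
      have : (X * A * Xᴴ) ^ 2 = X * (A * A * Xᴴ) := by
        rw [pow_two, show X * A * Xᴴ * (X * A * Xᴴ) = X * A * (Xᴴ * X) * A * Xᴴ by
          simp only [Matrix.mul_assoc], hX1]
        simp only [Matrix.mul_assoc, Matrix.mul_one]
      rw [this, Matrix.trace_mul_comm, Matrix.mul_assoc, hX1, Matrix.mul_one]
    have hdc : (d : ℂ) ≠ 0 := by
      exact_mod_cast (by omega : d ≠ 0)
    have hfin : ((conjMap X (proj ψ - (d : ℂ)⁻¹ • 1)) ^ 2).trace = ((((d : ℝ) - 1) / d : ℝ) : ℂ) := by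
      rw [hsq, Matrix.sub_mul, Matrix.mul_sub, Matrix.mul_sub, hpp]
      simp [htr]
      field_simp
      ring
    rw [hfin, Complex.ofReal_re]
  rw [unitarity, funext h, haarAvg_const (by omega)]
  have : (d : ℝ) - 1 ≠ 0 := by linarith
  field_simp

/-! ### Comparison with the two bounds -/

theorem norm_eq_one_of_star_mul_self {z : ℂ} (hz : star z * z = 1) : ‖z‖ = 1 := by
  have h : ‖star z * z‖ = 1 := by rw [hz, norm_one]
  rw [norm_mul, norm_star, ← pow_two] at h
  exact (pow_eq_one_iff_of_nonneg (norm_nonneg z) two_ne_zero).mp h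

/-- The square of the right-hand side is `(d²/2)(d² - P²)`, and `d²/2 ≥ 1`. -/
theorem sqrt_one_sub_le_boundRU (hd : 2 ≤ d) {P z : ℝ}
    (h : 1 - z ^ 2 ≤ (d : ℝ) ^ 2 - P ^ 2) (hP : P ^ 2 ≤ (d : ℝ) ^ 2) :
    √(1 - z ^ 2) ≤ boundRU d (1 - (P ^ 2 + d) / (d * (d + 1))) 1 := by
  have hd' : (2 : ℝ) ≤ d := by exact_mod_cast hd
  have h1 : (0 : ℝ) < (d : ℝ) - 1 := by linarith
  have e1 : (1 : ℝ) + 2 * d * (1 - (P ^ 2 + d) / (d * (d + 1))) / (d - 1) - 1 =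
      2 * ((d : ℝ) ^ 2 - P ^ 2) / ((d - 1) * (d + 1)) := by
    field_simp
    ring
  have e2 : (1 : ℝ) - 1 / (d : ℝ) ^ 2 = (d - 1) * (d + 1) / d ^ 2 := by
    field_simp
    ring
  rw [boundRU, cConst, e1, e2]
  apply Real.sqrt_le_iff.mpr ⟨by positivity, ?_⟩
  have h2 : (0 : ℝ) ≤ (d : ℝ) ^ 2 - P ^ 2 := by linarith
  rw [mul_pow, mul_pow, mul_pow, Real.sq_sqrt (by positivity), Real.sq_sqrt (by positivity)]
  have e3 : ((d : ℝ) ^ 2) ^ 2 * ((1 / 2) ^ 2 * ((d - 1) * (d + 1) / d ^ 2)) *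
      (2 * ((d : ℝ) ^ 2 - P ^ 2) / ((d - 1) * (d + 1))) = d ^ 2 / 2 * (d ^ 2 - P ^ 2) := by
    field_simp
  rw [e3]
  exact h.trans (le_mul_of_one_le_left h2 (by nlinarith))

theorem sqrt_one_sub_le_boundFD {F D z : ℝ} (hz : 0 ≤ z)
    (h : invP d F / d - √(((d : ℝ) - 2) * (d * invQ d F D + d ^ 2 - (d + 2) * invP d F ^ 2)) /
      (2 * d) ≤ z) : √(1 - z ^ 2) ≤ boundFD d F D := by
  refine Real.sqrt_le_sqrt (sub_le_sub_left ?_ 1)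
  exact pow_le_pow_left₀ (le_max_right _ _) (max_le h hz) 2

theorem invP_gateFid (hd : 0 < d) {P : ℝ} (hP : 0 ≤ P) :
    invP d ((P ^ 2 + d) / (d * (d + 1))) = P := by
  have hd' : (0 : ℝ) < d := by exact_mod_cast hd
  rw [invP, mul_div_cancel₀ _ (by positivity), add_sub_cancel_right, Real.sqrt_sq hP]

theorem le_invQ (hd : 0 < d) {F M P Q : ℝ} (hP : invP d F = P)
    (hM : M = (Q ^ 2 + 4 * (d + 2) * P ^ 2 + 2 * d * (d + 3)) /
      (d * (d + 1) * (d + 2) * (d + 3))) : Q ≤ invQ d F √(M - F ^ 2) := by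
  have hd' : (0 : ℝ) < d := by exact_mod_cast hd
  apply Real.le_sqrt_of_sq_le
  -- Since `√` vanishes on negative numbers, this inequality holds without showing that the variance
  -- is nonnegative; a lower bound on `invQ` is all that is needed.
  have h1 : M ≤ √(M - F ^ 2) ^ 2 + F ^ 2 := by
    rcases le_total 0 (M - F ^ 2) with h | h
    · rw [Real.sq_sqrt h]
      linarith
    · nlinarith [sq_nonneg √(M - F ^ 2)]
  have h2 : (d : ℝ) * (d + 1) * (d + 2) * (d + 3) * M =
      Q ^ 2 + 4 * (d + 2) * P ^ 2 + 2 * d * (d + 3) := by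
    rw [hM, mul_div_cancel₀ _ (by positivity)]
  have h3 := mul_le_mul_of_nonneg_left h1
    (by positivity : (0 : ℝ) ≤ (d : ℝ) * (d + 1) * (d + 2) * (d + 3))
  rw [hP]
  linarith

end HybridCert

end

open HybridCert
theorem theorem2 (d : ℕ) (hd : 4 ≤ d)
    (U : Matrix (Fin d) (Fin d) ℂ) (hU : U ∈ Matrix.unitaryGroup (Fin d) ℂ)
    (G : Superop d) (hG : IsChannel G)
    (h_unital : IsUnital (errorChannel U G))
    (h_leakage_free : IsTracePreserving (errorChannel U G))
    (h_coherent : IsUnitaryChannel (errorChannel U G)) :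
    diamondDist (errorChannel U G) LinearMap.id ≤
      min
        (boundRU d (infid (errorChannel U G)) (unitarity (errorChannel U G)))
        (boundFD d (gateFid (errorChannel U G)) (fidDev (errorChannel U G))) := by
  obtain ⟨X, hX, hE⟩ := h_coherent
  rw [hE]
  obtain ⟨W, hW, l, hl, hXW⟩ := exists_unitary_diagonalization hX
  have hl1 : ∀ j, ‖l j‖ = 1 := fun j => norm_eq_one_of_star_mul_self (hl j)
  have hu := unitarity_conjMap (by omega) hX
  subst hXW
  have hF := gateFid_conjMap (by omega) hW hl
  have hPd : ‖∑ j, l j‖ ^ 2 ≤ (d : ℝ) ^ 2 := by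
    refine pow_le_pow_left₀ (norm_nonneg _) ((norm_sum_le _ _).trans ?_) 2
    simp [hl1]
  have hbound : ∀ p : Fin d → ℝ, (∀ j, 0 ≤ p j) → ∑ j, p j = 1 →
      √(1 - ‖∑ j, (p j : ℂ) * l j‖ ^ 2) ≤ min
        (boundRU d (infid (conjMap (W * Matrix.diagonal l * Wᴴ)))
          (unitarity (conjMap (W * Matrix.diagonal l * Wᴴ))))
        (boundFD d (gateFid (conjMap (W * Matrix.diagonal l * Wᴴ)))
          (fidDev (conjMap (W * Matrix.diagonal l * Wᴴ)))) := by
    intro p hp hp1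
    refine le_min ?_ ?_
    · rw [hu, infid, hF]
      refine sqrt_one_sub_le_boundRU (by omega) ?_ hPd
      have := one_sub_norm_sq_le hl1 hp hp1
      rwa [Fintype.card_fin] at this
    · refine sqrt_one_sub_le_boundFD (norm_nonneg _) ?_
      have hP : invP d (gateFid (conjMap (W * Matrix.diagonal l * Wᴴ))) = ‖∑ j, l j‖ := by
        rw [hF, invP_gateFid (by omega) (norm_nonneg _)]
      rw [hP]
      exact overlap_le_norm (by omega) hl1 hp hp1
        (le_invQ (by omega) hP (haarAvg_stateFid_sq_conjMap (by omega) hW hl))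
  -- A point mass is an admissible weight; it serves only to show that the minimum of the bounds is
  -- nonnegative.
  have hp0 : ∀ j, 0 ≤ Pi.single (M := fun _ : Fin d => ℝ) ⟨0, by omega⟩ 1 j := fun j => by
    by_cases hj : j = ⟨0, by omega⟩ <;> simp [hj]
  exact diamondDist_conjMap_le hW hX
    ((Real.sqrt_nonneg _).trans (hbound _ hp0 (by simp))) hbound
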